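/- **Theorem.** Let $\mathcal X,\mathcal W$ be standard Borel spaces, $\mathcal Y=\{0,1\}$, $P_W$ a prior on $\mathcal W$ and $w\mapsto P_{Z|w}$ a probability kernel from $\mathcal W$ to $\mathcal X\times\mathcal Y$. For each $n$ let $W$, $Z^n=(Z_1,\dots,Z_n)$ with $Z_i=(X_i,Y_i)$, and $Z=(X,Y)$ have joint law $P_W\big(\prod_{i=1}^n P_{Z_i|W}\big)P_{Z|W}$ with $P_{Z_i|W}=P_{Z|W}$. For a loss $\ell:\mathcal Y\times\mathcal A\to[0,\infty]$ put $R_\ell(Y|V)=\inf_\psi \mathbb E[\ell(Y,\psi(V))]$ (infimum over measurable $\psi$ with values in $\mathcal A$) and $$\mathrm{MER}_\ell=R_\ell(Y|X,Z^n)-R_\ell(Y|X,W).$$ $\mathrm{MER}_{01}$ is the case $\ell(y,a)=\mathbf 1\{y\ne a\}$, $\mathcal A=\mathcal Y$; $\mathrm{MER}_{\log}$ is the case $\ell(y,q)=-\log q(y)$, where $\mathcal A$ is the set of probability mass functions on $\mathcal Y$. Let $H(\cdot|\cdot)$ denote conditional Shannon entropy in nats and $H_2(\cdot|\cdot)=H(\cdot|\cdot)/\log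 2$ conditional Shannon entropy in bits; $\log$ is the natural logarithm. 1. For every $n\ge 1$, $$\mathrm{MER}_{01}\le \tfrac12 H_2(Y|X,Z^n)\le \tfrac1{2n}H_2(Y^n|X^n),\qquad \tfrac12\mathrm{MER}_{\log}\le \tfrac12 H(Y|X,Z^n)\le \tfrac1{2n}H(Y^n|X^n).$$ 2. Suppose moreover that the model is realizable, i.e. $Y=g(X,W)$ almost surely for a measurable $g:\mathcal X\times\mathcal W\to\{0,1\}$, and that $\mathcal G=\{g(\cdot,w):w\in\mathcal W\}$ has finite VC dimension $d$, where the VC dimension is $\sup\{n:\sup_{x^n\in\mathcal X^n}|\{(g(x_1,w),\dots,g(x_n,w)):w\in\mathcal W\}|=2^n\}$. Then, as $n\to\infty$: (a) $\mathrm{MER}_{01}=O\big(\frac{d}{2n}\big)$, with an absolute implied constant (namely $2$). (b) $\frac12\mathrm{MER}_{\log}\le \frac{d\log(n+1)}{2n}$ for all $n\ge1$; and if $\lim_{n\to\infty}(n+1)H(Y|X,Z^n)$ exists (as a finite limit), then $\frac12\mathrm{MER}_{\log}=O\big(\frac{d}{2n}\big)$, with an implied constant that may depend on the model. (c) If, in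 addition, $X$ is independent of $W$ and $\lim_{n\to\infty}(n+1)H(Y|X,Z^n)$ exists in $[0,\infty]$, then $\frac12\mathrm{MER}_{\log}=O\big(\frac{d}{2n}\big)$ with any implied constant $c>1$: for every $c>1$, $\frac12\mathrm{MER}_{\log}\le c\,\frac{d}{2n}$ for all sufficiently large $n$. -/

import Mathlib

open MeasureTheory ProbabilityTheory Filter Topology
open scoped ENNReal

noncomputable section

namespace BayesMER

/-! ### Bayes risk, loss functions, conditional entropy -/

/-- The Bayes risk `R_ℓ(Y|V) = inf_ψ E[ℓ(Y, ψ(V))]` for a nonnegative loss `ℓ`, the infimum being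
over all measurable decision rules `ψ` from the space of `V` to the action space. -/
def bayesRisk {Ω 𝒴 𝒱 𝒜 : Type*} [MeasurableSpace Ω] [MeasurableSpace 𝒱] [MeasurableSpace 𝒜]
    (μ : Measure Ω) (ℓ : 𝒴 → 𝒜 → ℝ≥0∞) (Y : Ω → 𝒴) (V : Ω → 𝒱) : ℝ≥0∞ :=
  ⨅ (ψ : 𝒱 → 𝒜) (_ : Measurable ψ), ∫⁻ ω, ℓ (Y ω) (ψ (V ω)) ∂μ

/-- The zero-one loss `1{y ≠ a}`. -/
def zeroOneLoss {𝒴 : Type*} [DecidableEq 𝒴] (y a : 𝒴) : ℝ≥0∞ := if y = a then 0 else 1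

/-- The log loss `-log q(y)` (natural logarithm), with value `∞` when `q(y) = 0`, for a label in a
finite set; the actions are the probability mass functions `q` on that set. -/
def logLoss {𝒴 : Type*} [Fintype 𝒴] (y : 𝒴) (q : stdSimplex ℝ 𝒴) : ℝ≥0∞ :=
  if q.1 y = 0 then ∞ else ENNReal.ofReal (-Real.log (q.1 y))

/-- The conditional Shannon entropy in nats,
`H(Y|V) = -∫ P_V(dv) ∑_y P(Y = y | V = v) log P(Y = y | V = v)`,
of a random variable `Y` with finitely many values. -/
def condEntropy {Ω 𝒴 𝒱 : Type*} [MeasurableSpace Ω] [MeasurableSpace 𝒱] [Fintype 𝒴] [Nonempty 𝒴]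
    [MeasurableSpace 𝒴] [StandardBorelSpace 𝒴] (μ : Measure Ω) [IsFiniteMeasure μ]
    (Y : Ω → 𝒴) (V : Ω → 𝒱) : ℝ :=
  ∫ v, ∑ y, Real.negMulLog ((condDistrib Y V μ v).real {y}) ∂(μ.map V)

/-! ### The Bayesian generative model -/

section Model

variable {𝒲 𝒵 : Type*} [MeasurableSpace 𝒲] [MeasurableSpace 𝒵]

/-- The law of `n` i.i.d. samples from `P w`, as a kernel in `w`. -/
def iidKernel (P : Kernel 𝒲 𝒵) [IsMarkovKernel P] (n : ℕ) : Kernel 𝒲 (Fin n → 𝒵) where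
  toFun w := Measure.pi fun _ => P w
  measurable' := by
    refine Measurable.measure_of_isPiSystem_of_isProbabilityMeasure
      (S := Set.pi Set.univ '' Set.pi Set.univ fun _ : Fin n => {s : Set 𝒵 | MeasurableSet s})
      generateFrom_pi.symm isPiSystem_pi ?_
    rintro _ ⟨s, hs, rfl⟩
    simp only [Measure.pi_pi]
    exact Finset.measurable_prod _ fun i _ => P.measurable_coe (hs i (Set.mem_univ i))

instance (P : Kernel 𝒲 𝒵) [IsMarkovKernel P] (n : ℕ) : IsMarkovKernel (iidKernel P n) :=
  ⟨fun w => by change IsProbabilityMeasure (Measure.pi fun _ => P w); infer_instance⟩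

/-- The joint law `P_{W, Zⁿ, Z} = P_W (∏ᵢ P_{Zᵢ|W}) P_{Z|W}` of the model parameters, the data set
and the fresh sample, for the prior `π` and the model `w ↦ P w = P_{Z|w}`. -/
def joint (π : Measure 𝒲) (P : Kernel 𝒲 𝒵) [IsMarkovKernel P] (n : ℕ) :
    Measure (𝒲 × (Fin n → 𝒵) × 𝒵) :=
  π.compProd (iidKernel P n ×ₖ P)

instance (π : Measure 𝒲) [IsProbabilityMeasure π] (P : Kernel 𝒲 𝒵) [IsMarkovKernel P] (n : ℕ) :
    IsProbabilityMeasure (joint π P n) := by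
  unfold joint; infer_instance

end Model

section Supervised

variable {𝒲 𝒳 𝒴 : Type*} {n : ℕ}

/-- The model parameters `W`. -/
def rvW (ω : 𝒲 × (Fin n → 𝒳 × 𝒴) × (𝒳 × 𝒴)) : 𝒲 := ω.1

/-- The data set `Zⁿ`. -/
def rvData (ω : 𝒲 × (Fin n → 𝒳 × 𝒴) × (𝒳 × 𝒴)) : Fin n → 𝒳 × 𝒴 := ω.2.1

/-- The observations `Xⁿ` of the data set. -/
def rvXs (ω : 𝒲 × (Fin n → 𝒳 × 𝒴) × (𝒳 × 𝒴)) : Fin n → 𝒳 := fun i => (ω.2.1 i).1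

/-- The labels `Yⁿ` of the data set. -/
def rvYs (ω : 𝒲 × (Fin n → 𝒳 × 𝒴) × (𝒳 × 𝒴)) : Fin n → 𝒴 := fun i => (ω.2.1 i).2

/-- The fresh observation `X`. -/
def rvX (ω : 𝒲 × (Fin n → 𝒳 × 𝒴) × (𝒳 × 𝒴)) : 𝒳 := ω.2.2.1

/-- The quantity `Y` to be predicted. -/
def rvY (ω : 𝒲 × (Fin n → 𝒳 × 𝒴) × (𝒳 × 𝒴)) : 𝒴 := ω.2.2.2

variable [MeasurableSpace 𝒲] [MeasurableSpace 𝒳] [MeasurableSpace 𝒴]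

/-- The minimum excess risk `MER_ℓ = R_ℓ(Y|X,Zⁿ) - R_ℓ(Y|X,W)` with `n` data samples. -/
def MER {𝒜 : Type*} [MeasurableSpace 𝒜] (π : Measure 𝒲) (P : Kernel 𝒲 (𝒳 × 𝒴)) [IsMarkovKernel P]
    (ℓ : 𝒴 → 𝒜 → ℝ≥0∞) (n : ℕ) : ℝ :=
  (bayesRisk (joint π P n) ℓ rvY (fun ω => (rvX ω, rvData ω))).toReal
    - (bayesRisk (joint π P n) ℓ rvY (fun ω => (rvX ω, rvW ω))).toReal

/-- `MER` for the zero-one loss, with action space `𝒴`. -/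
def MER01 [DecidableEq 𝒴] (π : Measure 𝒲) (P : Kernel 𝒲 (𝒳 × 𝒴)) [IsMarkovKernel P] (n : ℕ) : ℝ :=
  MER π P (zeroOneLoss (𝒴 := 𝒴)) n

/-- `MER` for the log loss (in nats), with the probability mass functions on `𝒴` as actions. -/
def MERlog [Fintype 𝒴] (π : Measure 𝒲) (P : Kernel 𝒲 (𝒳 × 𝒴)) [IsMarkovKernel P] (n : ℕ) : ℝ :=
  MER π P (logLoss (𝒴 := 𝒴)) n

variable [Fintype 𝒴] [Nonempty 𝒴] [StandardBorelSpace 𝒴]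

/-- `H(Y|X,Zⁿ)`, in nats. -/
def entropyFresh (π : Measure 𝒲) [IsProbabilityMeasure π] (P : Kernel 𝒲 (𝒳 × 𝒴)) [IsMarkovKernel P]
    (n : ℕ) : ℝ :=
  condEntropy (joint π P n) rvY (fun ω => (rvX ω, rvData ω))

/-- `H(Yⁿ|Xⁿ)`, in nats. -/
def entropyData (π : Measure 𝒲) [IsProbabilityMeasure π] (P : Kernel 𝒲 (𝒳 × 𝒴)) [IsMarkovKernel P]
    (n : ℕ) : ℝ :=
  condEntropy (joint π P n) rvYs rvXs

end Supervised

/-- The model is realizable with generative function `g`: `Y = g(X, W)` almost surely. -/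
def Realizable {𝒲 𝒳 𝒴 : Type*} [MeasurableSpace 𝒲] [MeasurableSpace 𝒳] [MeasurableSpace 𝒴]
    (π : Measure 𝒲) (P : Kernel 𝒲 (𝒳 × 𝒴)) (g : 𝒳 → 𝒲 → 𝒴) : Prop :=
  ∀ᵐ p ∂(π.compProd P), p.2.2 = g p.2.1 p.1

/-- The VC dimension `sup {n | sup_{xⁿ} |{(g(x₁,w),…,g(xₙ,w)) : w}| = 2ⁿ}` of the class
`{g(·,w) : w ∈ 𝒲}` of binary functions. -/
def vcDim {𝒲 𝒳 : Type*} (g : 𝒳 → 𝒲 → Fin 2) : ℕ∞ :=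
  ⨆ n ∈ {n : ℕ | (⨆ x : Fin n → 𝒳, (Set.range fun (w : 𝒲) (i : Fin n) => g (x i) w).encard) = 2 ^ n},
    (n : ℕ∞)

end BayesMER

end

/-!
# Minimum excess risk in Bayesian learning: bounds by conditional entropies and the VC dimension
-/

namespace BayesMER

/-! ### Combinatorics of binary patterns -/

/-! The argument is carried out for Bayes risks, with entropies read off at the end: by Gibbs'
inequality the Bayes risk of the log loss is the conditional entropy (`bayesRisk_logLoss`). Risks
depend only on joint laws and do not increase when more is observed, so most conditional-entropy
manipulations become comparisons of decision rules.

Entropy bounds. By exchangeability the fresh sample may be any of `n + 1` samples (`freshRisk_eq`).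
Peeling labels off `Yⁿ⁺¹` one at a time, each chain-rule term observes all of `Xⁿ⁺¹` and the earlier
labels only, which is less than the remaining samples, so it is at least `H(Y|X,Zⁿ)`. Hence `(n + 1)
H(Y|X,Zⁿ) ≤ H(Yⁿ⁺¹|Xⁿ⁺¹)`, and monotonicity in `n` gives the stated form. The zero-one bound is `min
p (1 - p) ≤ h(p) / (2 log 2)`.

Realizable models. The risk given `W` vanishes, and given `Xⁿ` the labels live on the patterns cut
out by the class. Sauer–Shelah leaves at most `(n + 1) ^ d` of them, so `H(Yⁿ|Xⁿ) ≤ d log (n + 1)`.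
For the zero-one loss no logarithm appears: the sum of the `n + 1` leave-one-out errors is at most
the total of `min` over the edges of the cube of label patterns, and such a total is at most `d`
times the mass (`ShatterBound.sum_min_insertNth_le`).

If `X` is independent of `W`, an extra observation says nothing about earlier labels, so `H(Y|X,Zⁱ)`
summed over `i < n` is at most `H(Yⁿ|Xⁿ) ≤ d log (n + 1)`. Comparison with the harmonic series then
forbids a limit of `(n + 1) H(Y|X,Zⁿ)` above `d`. -/

/-- Every set of coordinates shattered by `S` has at most `d` elements. -/
def ShatterBound {n : ℕ} (S : Set (Fin n → Fin 2)) (d : ℕ) : Prop :=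
  ∀ s : Finset (Fin n), (∀ f : Fin n → Fin 2, ∃ y ∈ S, ∀ i ∈ s, y i = f i) → s.card ≤ d

lemma ShatterBound.mono {n d : ℕ} {S T : Set (Fin n → Fin 2)} (h : ShatterBound T d)
    (hST : S ⊆ T) : ShatterBound S d := fun s hs =>
  h s fun f => let ⟨y, hy, hyf⟩ := hs f; ⟨y, hST hy, hyf⟩

lemma ShatterBound.tail {n d : ℕ} {S : Set (Fin (n + 1) → Fin 2)} (h : ShatterBound S d) :
    ShatterBound {y | Fin.cons 0 y ∈ S ∨ Fin.cons 1 y ∈ S} d := by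
  intro s hs
  have := h (s.map (Fin.succEmb n)) fun f => by
    obtain ⟨y, hy, hyf⟩ := hs (Fin.tail f)
    rcases hy with hy | hy
    all_goals
      refine ⟨_, hy, fun i hi => ?_⟩
      obtain ⟨j, hj, rfl⟩ := Finset.mem_map.1 hi
      simpa [Fin.tail] using hyf j hj
  simpa using this

/-- When both extensions of a pattern lie in `S`, coordinate `0` is free, so it can be added to any
set shattered by such patterns. -/
lemma ShatterBound.card_add_one_le {n d : ℕ} {S : Set (Fin (n + 1) → Fin 2)}
    (h : ShatterBound S d) {s : Finset (Fin n)}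
    (hs : ∀ f : Fin n → Fin 2, ∃ y, (Fin.cons 0 y ∈ S ∧ Fin.cons 1 y ∈ S) ∧ ∀ i ∈ s, y i = f i) :
    s.card + 1 ≤ d := by
  have := h (insert 0 (s.map (Fin.succEmb n))) fun f => by
    obtain ⟨y, hy, hyf⟩ := hs (Fin.tail f)
    refine ⟨Fin.cons (f 0) y, ?_, fun i hi => ?_⟩
    · rcases Fin.exists_fin_two.1 ⟨f 0, rfl⟩ with h0 | h0
      · rw [h0]; exact hy.1
      · rw [h0]; exact hy.2
    · rcases Finset.mem_insert.1 hi with rfl | hi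
      · simp
      · obtain ⟨j, hj, rfl⟩ := Finset.mem_map.1 hi
        simpa [Fin.tail] using hyf j hj
  rwa [Finset.card_insert_of_notMem (by simp), Finset.card_map] at this

lemma ShatterBound.inter {n d : ℕ} {S : Set (Fin (n + 1) → Fin 2)} (h : ShatterBound S (d + 1)) :
    ShatterBound {y | Fin.cons 0 y ∈ S ∧ Fin.cons 1 y ∈ S} d := fun _ hs =>
  Nat.le_of_succ_le_succ (h.card_add_one_le hs)

lemma ShatterBound.not_both {n : ℕ} {S : Set (Fin (n + 1) → Fin 2)} (h : ShatterBound S 0)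
    (y : Fin n → Fin 2) : ¬(Fin.cons 0 y ∈ S ∧ Fin.cons 1 y ∈ S) := fun hy => by
  have := h.card_add_one_le (s := ∅) fun f => ⟨y, hy, by simp⟩
  simp at this

lemma sum_eq_sum_insertNth {M : Type*} [AddCommMonoid M] {n : ℕ} (i : Fin (n + 1))
    (f : (Fin (n + 1) → Fin 2) → M) :
    ∑ y, f y = ∑ y : Fin n → Fin 2, (f (i.insertNth 0 y) + f (i.insertNth 1 y)) := by
  rw [← (Fin.insertNthEquiv (fun _ => Fin 2) i).sum_comp, Fintype.sum_prod_type, Fin.sum_univ_two,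
    Finset.sum_add_distrib]
  rfl

lemma sum_eq_sum_cons {M : Type*} [AddCommMonoid M] {n : ℕ} (f : (Fin (n + 1) → Fin 2) → M) :
    ∑ y, f y = ∑ y : Fin n → Fin 2, (f (Fin.cons 0 y) + f (Fin.cons 1 y)) := by
  rw [sum_eq_sum_insertNth 0]
  simp only [Fin.insertNth_zero']

/-- The Sauer–Shelah bound, in the weak form `(n + 1) ^ d`. -/
lemma ShatterBound.card_le {n : ℕ} : ∀ {d : ℕ} (V : Finset (Fin n → Fin 2)),
    ShatterBound (V : Set (Fin n → Fin 2)) d → V.card ≤ (n + 1) ^ d := by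
  classical
  induction n with
  | zero =>
    intro d V _
    simpa using Finset.card_le_univ V
  | succ n ih =>
    intro d V h
    let U : Finset (Fin n → Fin 2) := {y | Fin.cons 0 y ∈ V ∨ Fin.cons 1 y ∈ V}
    let I : Finset (Fin n → Fin 2) := {y | Fin.cons 0 y ∈ V ∧ Fin.cons 1 y ∈ V}
    have hV : V.card = U.card + I.card := by
      have hc : ∀ {m : ℕ} (T : Finset (Fin m → Fin 2)), T.card = ∑ y, if y ∈ T then 1 else 0 := by
        intro m T; simp
      rw [hc V, hc U, hc I, sum_eq_sum_cons, ← Finset.sum_add_distrib]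
      refine Finset.sum_congr rfl fun y _ => ?_
      by_cases h0 : Fin.cons 0 y ∈ V <;> by_cases h1 : Fin.cons 1 y ∈ V <;> simp [U, I, h0, h1]
    have hU : U.card ≤ (n + 1) ^ d := ih U (by simpa [U] using h.tail)
    rw [hV]
    cases d with
    | zero =>
      have hI : I = ∅ := Finset.filter_eq_empty_iff.2 fun y _ => h.not_both y
      simpa [hI] using hU
    | succ d =>
      have hI : I.card ≤ (n + 1) ^ d := ih I (by simpa [I] using h.inter)
      calc U.card + I.card ≤ (n + 1) ^ (d + 1) + (n + 1) ^ d := add_le_add hU hI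
        _ = (n + 1) ^ d * (n + 1 + 1) := by ring
        _ ≤ (n + 1 + 1) ^ d * (n + 1 + 1) := by gcongr; omega
        _ = _ := by ring

/-- On a square face of the cube, `a, b` and `c, d` are the weights in the two halves. Replacing the
halves by their pointwise maximum and minimum does not decrease the edge weight in the other
direction. -/
lemma min_add_min_le (a b c d : ℝ≥0∞) :
    min a b + min c d ≤ min (max a c) (max b d) + min (min a c) (min b d) := by
  have h1 : max (min a b) (min c d) ≤ min (max a c) (max b d) :=
    max_le (min_le_min (le_max_left _ _) (le_max_left _ _))
      (min_le_min (le_max_right _ _) (le_max_right _ _))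
  have h2 : min (min a b) (min c d) = min (min a c) (min b d) := min_min_min_comm a b c d
  calc min a b + min c d = max (min a b) (min c d) + min (min a b) (min c d) :=
        (max_add_min _ _).symm
    _ ≤ _ := by rw [h2]; gcongr

/-- The weighted density bound for one-inclusion graphs: the edges of the cube, weighted by the
minimum of the weights of their end points, each being counted twice. -/
lemma ShatterBound.sum_min_update_le {n : ℕ} : ∀ {d : ℕ} (p : (Fin n → Fin 2) → ℝ≥0∞),
    ShatterBound {y | p y ≠ 0} d →
    ∑ i, ∑ y, min (p (Function.update y i 0)) (p (Function.update y i 1)) ≤ 2 * d * ∑ y, p y := by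
  induction n with
  | zero => intro d p _; simp
  | succ n ih =>
    intro d p h
    let U : (Fin n → Fin 2) → ℝ≥0∞ := fun y => max (p (Fin.cons 0 y)) (p (Fin.cons 1 y))
    let I : (Fin n → Fin 2) → ℝ≥0∞ := fun y => min (p (Fin.cons 0 y)) (p (Fin.cons 1 y))
    have hp : ∑ y, p y = ∑ y, U y + ∑ y, I y := by
      rw [sum_eq_sum_cons, ← Finset.sum_add_distrib]
      exact Finset.sum_congr rfl fun y _ => (max_add_min _ _).symm
    have hU : ShatterBound {y | U y ≠ 0} d := h.tail.mono fun y hy => by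
      by_contra hc
      simp only [Set.mem_ofPred_eq, not_or, not_not] at hc
      simp [U, hc.1, hc.2] at hy
    have hIS : {y | I y ≠ 0} ⊆ {y : Fin n → Fin 2 | Fin.cons 0 y ∈ {y | p y ≠ 0} ∧
        Fin.cons 1 y ∈ {y | p y ≠ 0}} := fun y hy => by
      refine ⟨fun h0 => hy ?_, fun h0 => hy ?_⟩ <;> simp [I, h0]
    -- Edges in direction `0` have total weight `∑ I`, counted twice; all other edges are handled by
    -- `min_add_min_le`. As `I` loses one dimension, `2 + 2 * d` copies of `∑ I` match `2 * (d + 1)`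
    -- copies of `∑ U`.
    have hsplit : ∑ i, ∑ y, min (p (Function.update y i 0)) (p (Function.update y i 1)) ≤
        2 * ∑ y, I y +
          (∑ i, ∑ y, min (U (Function.update y i 0)) (U (Function.update y i 1)) +
          ∑ i, ∑ y, min (I (Function.update y i 0)) (I (Function.update y i 1))) := by
      rw [Fin.sum_univ_succ, ← Finset.sum_add_distrib]
      refine add_le_add (le_of_eq ?_) (Finset.sum_le_sum fun i _ => ?_)
      · rw [sum_eq_sum_cons, Finset.mul_sum]
        refine Finset.sum_congr rfl fun y _ => ?_
        simp only [Fin.update_cons_zero, I]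
        rw [two_mul]
      · rw [sum_eq_sum_cons, ← Finset.sum_add_distrib]
        refine Finset.sum_le_sum fun y _ => ?_
        simp only [← Fin.cons_update, I, U]
        exact min_add_min_le _ _ _ _
    refine hsplit.trans ?_
    rw [hp]
    cases d with
    | zero =>
      have hI : ∀ y, I y = 0 := fun y => by
        by_contra hy
        exact h.not_both y (hIS hy)
      have := ih U hU
      simpa [hI] using this
    | succ d =>
      have hI : ShatterBound {y | I y ≠ 0} d := h.inter.mono hIS
      calc _ ≤ 2 * ∑ y, I y + (2 * (d + 1 : ℕ) * ∑ y, U y + 2 * d * ∑ y, I y) := by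
            gcongr
            · exact ih U hU
            · exact ih I hI
        _ = _ := by push_cast; ring

lemma ShatterBound.sum_min_insertNth_le {n d : ℕ} (p : (Fin (n + 1) → Fin 2) → ℝ≥0∞)
    (h : ShatterBound {y | p y ≠ 0} d) :
    ∑ i : Fin (n + 1), ∑ y : Fin n → Fin 2, min (p (i.insertNth 0 y)) (p (i.insertNth 1 y))
      ≤ d * ∑ y, p y := by
  have := h.sum_min_update_le
  have h2 : ∑ i, ∑ y, min (p (Function.update y i 0)) (p (Function.update y i 1)) =
      2 * ∑ i : Fin (n + 1), ∑ y : Fin n → Fin 2,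
        min (p (i.insertNth 0 y)) (p (i.insertNth 1 y)) := by
    rw [Finset.mul_sum]
    refine Finset.sum_congr rfl fun i _ => ?_
    rw [sum_eq_sum_insertNth i, Finset.mul_sum]
    refine Finset.sum_congr rfl fun y _ => ?_
    simp only [Fin.update_insertNth]
    rw [two_mul]
  rw [h2, mul_assoc] at this
  exact (ENNReal.mul_le_mul_iff_right (by simp) (by simp)).1 this

/-- A class of VC dimension `d` shatters at most `d` coordinates of any tuple. -/
lemma shatterBound_of_vcDim {𝒲 𝒳 : Type*} {g : 𝒳 → 𝒲 → Fin 2} {d : ℕ} (h : vcDim g = d) {n : ℕ}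
    (x : Fin n → 𝒳) :
    ShatterBound (Set.range fun (w : 𝒲) (i : Fin n) => g (x i) w) d := by
  intro s hs
  have hle : ∀ z : Fin s.card → 𝒳,
      (Set.range fun (w : 𝒲) (i : Fin s.card) => g (z i) w).encard ≤ 2 ^ s.card := fun z => by
    refine (Set.encard_le_encard (Set.subset_univ _)).trans ?_
    rw [Set.encard_univ]
    simp
  have hmem : (⨆ z : Fin s.card → 𝒳,
      (Set.range fun (w : 𝒲) (i : Fin s.card) => g (z i) w).encard) = 2 ^ s.card := by
    refine le_antisymm (iSup_le hle) ?_
    -- The tuple realizing all patterns is `x` restricted to `s`, listed in increasing order; target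
    -- values off `s` are irrelevant and set to `0`.
    refine le_iSup_of_le (fun i => x (s.orderEmbOfFin rfl i)) ?_
    rw [Set.range_eq_univ.2 fun f => ?_, Set.encard_univ]
    · simp
    classical
    obtain ⟨_, ⟨w, rfl⟩, hw⟩ := hs fun i =>
      if hi : i ∈ s then f ((s.orderIsoOfFin rfl).symm ⟨i, hi⟩) else 0
    refine ⟨w, funext fun i => ?_⟩
    have hi := hw (s.orderEmbOfFin rfl i) (s.orderEmbOfFin_mem rfl i)
    simp only [Finset.orderEmbOfFin_mem, dite_true] at hi
    rw [hi]
    congr 1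
    rw [OrderIso.symm_apply_eq]
    rfl
  have : (s.card : ℕ∞) ≤ vcDim g := le_iSup₂_of_le (f := fun (n : ℕ) (_ : n ∈ {n : ℕ |
    (⨆ x : Fin n → 𝒳, (Set.range fun (w : 𝒲) (i : Fin n) => g (x i) w).encard) = 2 ^ n}) =>
      (n : ℕ∞)) s.card hmem le_rfl
  rw [h] at this
  exact_mod_cast this

/-! ### General properties of Bayes risks -/

section Risk

variable {Ω Ω' 𝒴 𝒱 𝒱' 𝒜 : Type*} [MeasurableSpace Ω] [MeasurableSpace Ω'] [MeasurableSpace 𝒱]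
  [MeasurableSpace 𝒱'] [MeasurableSpace 𝒜]

lemma bayesRisk_le (μ : Measure Ω) (ℓ : 𝒴 → 𝒜 → ℝ≥0∞) (Y : Ω → 𝒴) (V : Ω → 𝒱) {ψ : 𝒱 → 𝒜}
    (hψ : Measurable ψ) : bayesRisk μ ℓ Y V ≤ ∫⁻ ω, ℓ (Y ω) (ψ (V ω)) ∂μ :=
  iInf₂_le ψ hψ

/-- Observing a function of `V` does not decrease the Bayes risk. -/
lemma bayesRisk_le_of_comp (μ : Measure Ω) (ℓ : 𝒴 → 𝒜 → ℝ≥0∞) (Y : Ω → 𝒴) {V : Ω → 𝒱}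
    {V' : Ω → 𝒱'} {f : 𝒱 → 𝒱'} (hf : Measurable f) (hV : ∀ ω, V' ω = f (V ω)) :
    bayesRisk μ ℓ Y V ≤ bayesRisk μ ℓ Y V' := by
  refine le_iInf₂ fun ψ hψ => (bayesRisk_le μ ℓ Y V (hψ.comp hf)).trans_eq ?_
  simp [hV]

/-- The Bayes risk depends only on the joint law of the label and the observation. -/
lemma bayesRisk_map [MeasurableSpace 𝒴] (μ : Measure Ω) {ℓ : 𝒴 → 𝒜 → ℝ≥0∞} (hℓ : Measurable (Function.uncurry ℓ))
    {T : Ω → Ω'} (hT : Measurable T) {Y : Ω' → 𝒴} (hY : Measurable Y) {V : Ω' → 𝒱}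
    (hV : Measurable V) :
    bayesRisk (μ.map T) ℓ Y V = bayesRisk μ ℓ (fun ω => Y (T ω)) (fun ω => V (T ω)) := by
  unfold bayesRisk
  refine iInf_congr fun ψ => iInf_congr fun hψ => ?_
  exact lintegral_map (f := fun ω => ℓ (Y ω) (ψ (V ω)))
    (hℓ.comp (hY.prodMk (hψ.comp hV))) hT

/-- Observing in addition a variable that is independent of label and observation does not
decrease the Bayes risk. -/
lemma bayesRisk_le_of_prod [MeasurableSpace 𝒴] (μ : Measure Ω) {τ : Measure 𝒱'} [IsProbabilityMeasure τ]
    {ℓ : 𝒴 → 𝒜 → ℝ≥0∞} (hℓ : Measurable (Function.uncurry ℓ))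
    {Y : Ω → 𝒴} (hY : Measurable Y) {V : Ω → 𝒱} (hV : Measurable V) [SFinite μ] :
    bayesRisk μ ℓ Y V ≤ bayesRisk (μ.prod τ) ℓ (fun ω => Y ω.1) (fun ω => (V ω.1, ω.2)) := by
  refine le_iInf₂ fun ψ hψ => ?_
  have hm : Measurable fun ω : Ω × 𝒱' => ℓ (Y ω.1) (ψ (V ω.1, ω.2)) :=
    hℓ.comp ((hY.comp measurable_fst).prodMk
      (hψ.comp ((hV.comp measurable_fst).prodMk measurable_snd)))
  rw [lintegral_prod_symm _ hm.aemeasurable]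
  -- Freezing the independent variable at `t` leaves an admissible rule for `V` alone; average over
  -- `t`.
  calc bayesRisk μ ℓ Y V = ∫⁻ _, bayesRisk μ ℓ Y V ∂τ := by simp
    _ ≤ _ := lintegral_mono fun t =>
        bayesRisk_le μ ℓ Y V (ψ := fun v => ψ (v, t)) (hψ.comp (measurable_id.prodMk measurable_const))

end Risk

lemma measurable_zeroOneLoss {𝒴 : Type*} [DecidableEq 𝒴] [MeasurableSpace 𝒴] [Countable 𝒴]
    [MeasurableSingletonClass 𝒴] : Measurable (Function.uncurry (zeroOneLoss (𝒴 := 𝒴))) :=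
  measurable_of_countable _

lemma measurable_logLoss_apply {𝒴 : Type*} [Fintype 𝒴] (y : 𝒴) : Measurable (logLoss y) := by
  have h : Measurable fun q : stdSimplex ℝ 𝒴 => q.1 y :=
    (measurable_pi_apply y).comp measurable_subtype_coe
  exact Measurable.ite (h (measurableSet_singleton 0)) measurable_const
    (Real.measurable_log.comp h).neg.ennreal_ofReal

lemma measurable_logLoss {𝒴 : Type*} [Fintype 𝒴] [MeasurableSpace 𝒴] [MeasurableSingletonClass 𝒴] :
    Measurable (Function.uncurry (logLoss (𝒴 := 𝒴))) :=
  measurable_from_prod_countable_right measurable_logLoss_apply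

/-! ### The chain rule for the log loss -/

lemma ofReal_neg_log_add {a b : ℝ} (ha : 0 < a) (ha1 : a ≤ 1) (hb : 0 < b) (hb1 : b ≤ 1) :
    ENNReal.ofReal (-Real.log a) + ENNReal.ofReal (-Real.log b)
      = ENNReal.ofReal (-Real.log (a * b)) := by
  rw [← ENNReal.ofReal_add, Real.log_mul ha.ne' hb.ne', neg_add]
  · simpa using Real.log_nonpos ha.le ha1
  · simpa using Real.log_nonpos hb.le hb1

lemma stdSimplex_le_one {𝒴 : Type*} [Fintype 𝒴] (q : stdSimplex ℝ 𝒴) (y : 𝒴) : q.1 y ≤ 1 := by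
  rw [← q.2.2]
  exact Finset.single_le_sum (fun i _ => q.2.1 i) (Finset.mem_univ y)

section Chain

variable {𝒜 ℬ 𝒞 : Type*} [Fintype 𝒜] [Fintype ℬ] [Fintype 𝒞] [DecidableEq 𝒜] [DecidableEq ℬ]

/-- The law of `f` under a probability mass function. -/
def pushSimplex (f : 𝒞 → 𝒜) (q : stdSimplex ℝ 𝒞) : stdSimplex ℝ 𝒜 :=
  ⟨fun a => ∑ c with f c = a, q.1 c, fun _ => Finset.sum_nonneg fun c _ => q.2.1 c, by
    rw [Finset.sum_fiberwise]; exact q.2.2⟩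

/-- The conditional law of `g` given `f = a`, equal to a point mass if `f = a` has probability
zero. -/
noncomputable def condSimplex [Nonempty ℬ] (f : 𝒞 → 𝒜) (g : 𝒞 → ℬ) (q : stdSimplex ℝ 𝒞) (a : 𝒜) :
    stdSimplex ℝ ℬ :=
  ⟨fun b => if (pushSimplex f q).1 a = 0 then if b = Classical.arbitrary ℬ then 1 else 0 else
      (∑ c with f c = a ∧ g c = b, q.1 c) / (pushSimplex f q).1 a, by
    refine ⟨fun b => ?_, ?_⟩
    · dsimp only
      split_ifs
      · exact zero_le_one
      · exact le_rfl
      · exact div_nonneg (Finset.sum_nonneg fun c _ => q.2.1 c) ((pushSimplex f q).2.1 a)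
    · split_ifs with h
      · simp
      · rw [← Finset.sum_div, div_eq_one_iff_eq h]
        simp only [← Finset.filter_filter]
        rw [Finset.sum_fiberwise]
        rfl⟩

lemma measurable_pushSimplex (f : 𝒞 → 𝒜) : Measurable (pushSimplex f) := by
  refine Measurable.subtype_mk (measurable_pi_iff.2 fun a => Finset.measurable_sum _ fun c _ => ?_)
  exact (measurable_pi_apply c).comp measurable_subtype_coe

lemma measurable_condSimplex [Nonempty ℬ] (f : 𝒞 → 𝒜) (g : 𝒞 → ℬ) (a : 𝒜) :
    Measurable fun q => condSimplex f g q a := by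
  have h : Measurable fun q : stdSimplex ℝ 𝒞 => (pushSimplex f q).1 a :=
    (measurable_pi_apply a).comp (measurable_subtype_coe.comp (measurable_pushSimplex f))
  refine Measurable.subtype_mk (measurable_pi_iff.2 fun b => ?_)
  refine Measurable.ite (h (measurableSet_singleton 0)) measurable_const
    (Measurable.div (Finset.measurable_sum _ fun c _ => ?_) h)
  exact (measurable_pi_apply c).comp measurable_subtype_coe

/-- Since `c` is determined by `(f c, g c)`, its mass is marginal times conditional, and the
logarithm is additive. If `q` gives `c` no mass, the right side is `∞`. -/
lemma logLoss_chain [Nonempty ℬ] {f : 𝒞 → 𝒜} {g : 𝒞 → ℬ}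
    (hfg : Function.Injective fun c => (f c, g c)) (q : stdSimplex ℝ 𝒞) (c : 𝒞) :
    logLoss (f c) (pushSimplex f q) + logLoss (g c) (condSimplex f g q (f c)) ≤ logLoss c q := by
  by_cases hc : q.1 c = 0
  · simp [logLoss, hc]
  have hc0 : 0 < q.1 c := lt_of_le_of_ne (q.2.1 c) (Ne.symm hc)
  have hf : 0 < (pushSimplex f q).1 (f c) :=
    hc0.trans_le (Finset.single_le_sum (f := q.1) (fun i _ => q.2.1 i) (by simp))
  have hcond : (condSimplex f g q (f c)).1 (g c) = q.1 c / (pushSimplex f q).1 (f c) := by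
    have hs : Finset.univ.filter (fun c' => f c' = f c ∧ g c' = g c) = {c} := by
      ext c'
      simp only [Finset.mem_filter, Finset.mem_univ, true_and, Finset.mem_singleton]
      exact ⟨fun h => hfg (Prod.ext h.1 h.2), fun h => by simp [h]⟩
    simp only [condSimplex, hf.ne', if_false, hs, Finset.sum_singleton]
  have hq : 0 < (condSimplex f g q (f c)).1 (g c) := by rw [hcond]; positivity
  simp only [logLoss, hc, hf.ne', hq.ne', if_false]
  rw [ofReal_neg_log_add hf (stdSimplex_le_one _ _) hq (stdSimplex_le_one _ _), hcond,
    mul_div_cancel₀ _ hf.ne']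

/-- Every predictor of `C` splits into a marginal predictor of `f C` and a conditional predictor of
`g C` that also sees `f C`. Only this half of the chain rule is needed. -/
lemma bayesRisk_logLoss_chain [Nonempty ℬ] {Ω 𝒱 : Type*} [MeasurableSpace Ω] [MeasurableSpace 𝒱]
    [MeasurableSpace 𝒜] [MeasurableSingletonClass 𝒜]
    (μ : Measure Ω) {f : 𝒞 → 𝒜} {g : 𝒞 → ℬ} (hfg : Function.Injective fun c => (f c, g c))
    [MeasurableSpace 𝒞] [MeasurableSingletonClass 𝒞]
    {C : Ω → 𝒞} (hC : Measurable C) {V : Ω → 𝒱} (hV : Measurable V) :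
    bayesRisk μ logLoss (fun ω => f (C ω)) V
        + bayesRisk μ logLoss (fun ω => g (C ω)) (fun ω => (V ω, f (C ω)))
      ≤ bayesRisk μ logLoss C V := by
  refine le_iInf₂ fun ψ hψ => ?_
  have h1 : Measurable fun v => pushSimplex f (ψ v) := (measurable_pushSimplex f).comp hψ
  have h2 : Measurable fun v : 𝒱 × 𝒜 => condSimplex f g (ψ v.1) v.2 :=
    measurable_from_prod_countable_left fun a => (measurable_condSimplex f g a).comp hψ
  refine (add_le_add (bayesRisk_le μ _ _ V h1) (bayesRisk_le μ _ _ _ h2)).trans ?_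
  rw [← lintegral_add_left]
  · exact lintegral_mono fun ω => logLoss_chain hfg _ _
  · exact measurable_logLoss.comp (((measurable_of_countable f).comp hC).prodMk (h1.comp hV))

end Chain

/-! ### Bayes risks and conditional entropy -/

section Entropy

variable {Ω 𝒴 𝒱 : Type*} [MeasurableSpace Ω] [MeasurableSpace 𝒱] [Fintype 𝒴] [Nonempty 𝒴]
    [MeasurableSpace 𝒴] [StandardBorelSpace 𝒴]

/-- Gibbs' inequality. -/
lemma ofReal_sum_negMulLog_le {𝒴 : Type*} [Fintype 𝒴] (p q : stdSimplex ℝ 𝒴) :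
    ENNReal.ofReal (∑ y, Real.negMulLog (p.1 y))
      ≤ ∑ y, logLoss y q * ENNReal.ofReal (p.1 y) := by
  by_cases h : ∃ y, q.1 y = 0 ∧ p.1 y ≠ 0
  · obtain ⟨y, hq, hp⟩ := h
    have hp0 : 0 < p.1 y := lt_of_le_of_ne (p.2.1 y) (Ne.symm hp)
    refine le_top.trans_eq (Eq.symm ?_)
    rw [ENNReal.sum_eq_top]
    refine ⟨y, Finset.mem_univ y, ?_⟩
    simp [logLoss, hq, ENNReal.top_mul, hp0]
  push Not at h
  -- This is `log t ≤ t - 1` at `t = q / p`; the corrections `q - p` sum to zero.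
  have key : ∀ y, Real.negMulLog (p.1 y) ≤ -Real.log (q.1 y) * p.1 y + (q.1 y - p.1 y) := by
    intro y
    rcases (p.2.1 y).eq_or_lt with hp | hp
    · simp only [← hp]
      simpa using q.2.1 y
    have hq : 0 < q.1 y := lt_of_le_of_ne (q.2.1 y) fun hq => hp.ne' (h y hq.symm)
    have := Real.log_le_sub_one_of_pos (div_pos hq hp)
    rw [Real.log_div hq.ne' hp.ne'] at this
    have h3 := mul_le_mul_of_nonneg_left this hp.le
    have h4 : p.1 y * (q.1 y / p.1 y - 1) = q.1 y - p.1 y := by field_simp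
    rw [Real.negMulLog]
    nlinarith
  have hloss : ∀ y, logLoss y q * ENNReal.ofReal (p.1 y)
      = ENNReal.ofReal (-Real.log (q.1 y) * p.1 y) := by
    intro y
    have hnn : 0 ≤ -Real.log (q.1 y) := by
      simpa using Real.log_nonpos (q.2.1 y) (stdSimplex_le_one q y)
    by_cases hq : q.1 y = 0
    · simp [h y hq]
    · rw [logLoss, if_neg hq, ENNReal.ofReal_mul hnn]
  simp only [hloss]
  rw [← ENNReal.ofReal_sum_of_nonneg]
  · refine ENNReal.ofReal_le_ofReal ((Finset.sum_le_sum fun y _ => key y).trans_eq ?_)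
    rw [Finset.sum_add_distrib, Finset.sum_sub_distrib, q.2.2, p.2.2]
    ring
  · intro y _
    exact mul_nonneg (by simpa using Real.log_nonpos (q.2.1 y) (stdSimplex_le_one q y)) (p.2.1 y)

lemma sum_logLoss_self {𝒴 : Type*} [Fintype 𝒴] (p : stdSimplex ℝ 𝒴) :
    ∑ y, logLoss y p * ENNReal.ofReal (p.1 y)
      = ENNReal.ofReal (∑ y, Real.negMulLog (p.1 y)) := by
  rw [ENNReal.ofReal_sum_of_nonneg fun y _ => Real.negMulLog_nonneg (p.2.1 y)
    (stdSimplex_le_one p y)]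
  refine Finset.sum_congr rfl fun y _ => ?_
  by_cases hp : p.1 y = 0
  · simp [hp]
  · rw [logLoss, if_neg hp, ← ENNReal.ofReal_mul' (p.2.1 y), Real.negMulLog]
    ring_nf

/-- The mass function of a Markov kernel to a finite space. -/
noncomputable def kernelSimplex (κ : Kernel 𝒱 𝒴) [IsMarkovKernel κ] (v : 𝒱) : stdSimplex ℝ 𝒴 :=
  ⟨fun y => (κ v).real {y}, fun _ => measureReal_nonneg, by
    rw [sum_measureReal_singleton]; simp⟩

lemma measurable_kernelSimplex {𝒱 𝒴 : Type*} [MeasurableSpace 𝒱] [Fintype 𝒴] [MeasurableSpace 𝒴]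
    [StandardBorelSpace 𝒴] (κ : Kernel 𝒱 𝒴) [IsMarkovKernel κ] :
    Measurable (kernelSimplex κ) :=
  Measurable.subtype_mk (measurable_pi_iff.2 fun y =>
    (κ.measurable_coe (measurableSet_singleton y)).ennreal_toReal)

/-- Disintegration along `V` turns an expected loss into a finite sum at each `v`, so that decision
rules can be compared pointwise. -/
lemma lintegral_loss_eq (μ : Measure Ω) [IsFiniteMeasure μ] {Y : Ω → 𝒴} (hY : Measurable Y)
    {V : Ω → 𝒱} (hV : Measurable V) {F : 𝒴 → 𝒱 → ℝ≥0∞} (hF : ∀ y, Measurable (F y)) :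
    ∫⁻ ω, F (Y ω) (V ω) ∂μ
      = ∫⁻ v, ∑ y, F y v * ENNReal.ofReal ((kernelSimplex (condDistrib Y V μ) v).1 y)
          ∂(μ.map V) := by
  have hF' : Measurable fun p : 𝒱 × 𝒴 => F p.2 p.1 :=
    measurable_from_prod_countable_left hF
  rw [← lintegral_map (f := fun p : 𝒱 × 𝒴 => F p.2 p.1) hF' (hV.prodMk hY),
    ← compProd_map_condDistrib hY.aemeasurable, Measure.lintegral_compProd hF']
  refine lintegral_congr fun v => ?_
  rw [lintegral_fintype]
  simp [kernelSimplex]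

lemma condEntropy_nonneg (μ : Measure Ω) [IsFiniteMeasure μ] (Y : Ω → 𝒴) (V : Ω → 𝒱) :
    0 ≤ condEntropy μ Y V :=
  integral_nonneg fun _ => Finset.sum_nonneg fun _ _ =>
    Real.negMulLog_nonneg measureReal_nonneg measureReal_le_one

lemma ofReal_condEntropy (μ : Measure Ω) [IsFiniteMeasure μ] (Y : Ω → 𝒴) (V : Ω → 𝒱) :
    ENNReal.ofReal (condEntropy μ Y V)
      = ∫⁻ v, ENNReal.ofReal (∑ y, Real.negMulLog ((kernelSimplex (condDistrib Y V μ) v).1 y))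
          ∂(μ.map V) := by
  refine ofReal_integral_eq_lintegral_ofReal (integrable_finsetSum _ fun y _ => ?_)
    (ae_of_all _ fun _ => Finset.sum_nonneg fun _ _ =>
      Real.negMulLog_nonneg measureReal_nonneg measureReal_le_one)
  refine Integrable.of_bound (C := 1) ?_ (ae_of_all _ fun v => ?_)
  · exact (Real.continuous_negMulLog.measurable.comp ((condDistrib Y V μ).measurable_coe
      (measurableSet_singleton y)).ennreal_toReal).aestronglyMeasurable
  · have h0 : 0 ≤ (condDistrib Y V μ v).real {y} := measureReal_nonneg
    have h1 : (condDistrib Y V μ v).real {y} ≤ 1 := measureReal_le_one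
    rw [Real.norm_of_nonneg (Real.negMulLog_nonneg h0 h1)]
    rcases h0.eq_or_lt with h | h
    · simp [← h]
    · have h2 := mul_le_mul_of_nonneg_left (Real.one_sub_inv_le_log_of_pos h) h.le
      rw [mul_sub, mul_inv_cancel₀ h.ne'] at h2
      rw [Real.negMulLog]
      linarith

/-- The Bayes risk for the log loss is the conditional entropy. -/
lemma bayesRisk_logLoss (μ : Measure Ω) [IsFiniteMeasure μ] {Y : Ω → 𝒴} (hY : Measurable Y)
    {V : Ω → 𝒱} (hV : Measurable V) :
    bayesRisk μ logLoss Y V = ENNReal.ofReal (condEntropy μ Y V) := by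
  rw [ofReal_condEntropy]
  refine le_antisymm ?_ (le_iInf₂ fun ψ hψ => ?_)
  · refine (bayesRisk_le μ _ Y V (measurable_kernelSimplex (condDistrib Y V μ))).trans_eq ?_
    rw [lintegral_loss_eq μ hY hV (F := fun y v => logLoss y (kernelSimplex (condDistrib Y V μ) v))
      fun y => (measurable_logLoss_apply y).comp (measurable_kernelSimplex _)]
    exact lintegral_congr fun v => sum_logLoss_self _
  · rw [lintegral_loss_eq μ hY hV (F := fun y v => logLoss y (ψ v))
      fun y => (measurable_logLoss_apply y).comp hψ]
    exact lintegral_mono fun v => ofReal_sum_negMulLog_le _ _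

end Entropy

/-- By concavity the binary entropy lies above its chord from `(0, 0)` to `(1/2, log 2)`; symmetry
covers `p ≥ 1/2`. -/
lemma min_le_binEntropy {p : ℝ} (h0 : 0 ≤ p) (h1 : p ≤ 1) :
    min p (1 - p) ≤ Real.binEntropy p / (2 * Real.log 2) := by
  have hl : 0 < Real.log 2 := Real.log_pos one_lt_two
  have key : ∀ q : ℝ, 0 ≤ q → q ≤ 1 / 2 → q ≤ Real.binEntropy q / (2 * Real.log 2) := by
    intro q hq0 hq
    have := Real.strictConcave_binEntropy.concaveOn.2 (show (0 : ℝ) ∈ Set.Icc 0 1 by simp)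
      (show (2⁻¹ : ℝ) ∈ Set.Icc 0 1 by constructor <;> norm_num)
      (show 0 ≤ 1 - 2 * q by linarith) (show 0 ≤ 2 * q by linarith) (by ring)
    simp only [Real.binEntropy_zero, smul_eq_mul, mul_zero, zero_add, Real.binEntropy_two_inv] at this
    rw [le_div_iff₀ (by positivity)]
    have e : 2 * q * (2⁻¹ : ℝ) = q := by ring
    rw [e] at this
    linarith
  rcases le_total p (1 / 2) with h | h
  · exact (min_le_left _ _).trans (key p h0 h)
  · refine (min_le_right _ _).trans ?_
    rw [← Real.binEntropy_one_sub]
    exact key _ (by linarith) (by linarith)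

/-- The zero-one Bayes risk of a binary label is at most half of its conditional entropy in bits. -/
lemma bayesRisk_zeroOneLoss_le {Ω 𝒱 : Type*} [MeasurableSpace Ω] [MeasurableSpace 𝒱]
    (μ : Measure Ω) [IsFiniteMeasure μ] {Y : Ω → Fin 2} (hY : Measurable Y)
    {V : Ω → 𝒱} (hV : Measurable V) :
    bayesRisk μ zeroOneLoss Y V
      ≤ ENNReal.ofReal (1 / 2 * (condEntropy μ Y V / Real.log 2)) := by
  have hl : 0 < Real.log 2 := Real.log_pos one_lt_two
  set κ := kernelSimplex (condDistrib Y V μ)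
  have hκ : Measurable κ := measurable_kernelSimplex _
  have hκ' : ∀ y, Measurable fun v => (κ v).1 y := fun y =>
    (measurable_pi_apply y).comp (measurable_subtype_coe.comp hκ)
  -- The maximum a posteriori rule, whose conditional error is the smaller of the two probabilities.
  have hψ : Measurable fun v => if (κ v).1 0 ≤ (κ v).1 1 then (1 : Fin 2) else 0 :=
    Measurable.ite (measurableSet_le (hκ' 0) (hκ' 1)) measurable_const measurable_const
  refine (bayesRisk_le μ _ Y V hψ).trans ?_
  rw [lintegral_loss_eq μ hY hV (F := fun y v => zeroOneLoss y
    (if (κ v).1 0 ≤ (κ v).1 1 then (1 : Fin 2) else 0))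
    fun y => measurable_zeroOneLoss.comp (measurable_const.prodMk hψ)]
  have e : 1 / 2 * (condEntropy μ Y V / Real.log 2)
      = (2 * Real.log 2)⁻¹ * condEntropy μ Y V := by field_simp
  rw [e, ENNReal.ofReal_mul (by positivity), ofReal_condEntropy, ← lintegral_const_mul']
  · refine lintegral_mono fun v => ?_
    have hsum : (κ v).1 0 + (κ v).1 1 = 1 := by
      have := (κ v).2.2
      rwa [Fin.sum_univ_two] at this
    have h0 := (κ v).2.1 0
    have h1 := (κ v).2.1 1
    rw [← ENNReal.ofReal_mul (by positivity), Fin.sum_univ_two, Fin.sum_univ_two]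
    have hm := min_le_binEntropy h0 (by linarith)
    have e1 : 1 - (κ v).1 0 = (κ v).1 1 := by linarith
    rw [Real.binEntropy_eq_negMulLog_add_negMulLog_one_sub, e1, div_eq_inv_mul] at hm
    refine le_trans ?_ (ENNReal.ofReal_le_ofReal hm)
    split_ifs with h
    · simp [zeroOneLoss, h, κ]
    · simp [zeroOneLoss, (not_le.1 h).le, κ]
  · exact ENNReal.ofReal_ne_top

/-! ### The law of the model parameters and the data set -/

section Data

variable {𝒲 𝒵 : Type*} [MeasurableSpace 𝒲] [MeasurableSpace 𝒵]

/-- The joint law of the model parameters and the data set. -/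
noncomputable def dataLaw (π : Measure 𝒲) (P : Kernel 𝒲 𝒵) [IsMarkovKernel P] (n : ℕ) :
    Measure (𝒲 × (Fin n → 𝒵)) :=
  π.compProd (iidKernel P n)

variable (π : Measure 𝒲) [IsProbabilityMeasure π] (P : Kernel 𝒲 𝒵) [IsMarkovKernel P]

instance (n : ℕ) : IsProbabilityMeasure (dataLaw π P n) := by
  unfold dataLaw; infer_instance

lemma lintegral_dataLaw (n : ℕ) {f : 𝒲 × (Fin n → 𝒵) → ℝ≥0∞} (hf : Measurable f) :
    ∫⁻ ω, f ω ∂(dataLaw π P n) = ∫⁻ w, ∫⁻ z, f (w, z) ∂(Measure.pi fun _ => P w) ∂π :=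
  Measure.lintegral_compProd hf

lemma lintegral_joint (n : ℕ) {f : 𝒲 × (Fin n → 𝒵) × 𝒵 → ℝ≥0∞} (hf : Measurable f) :
    ∫⁻ ω, f ω ∂(joint π P n)
      = ∫⁻ w, ∫⁻ z, ∫⁻ t, f (w, z, t) ∂(P w) ∂(Measure.pi fun _ => P w) ∂π := by
  rw [joint, Measure.lintegral_compProd hf]
  refine lintegral_congr fun w => ?_
  rw [Kernel.prod_apply]
  exact lintegral_prod (fun b => f (w, b)) (hf.comp measurable_prodMk_left).aemeasurable

lemma joint_map_data (n : ℕ) : (joint π P n).map (fun ω => (ω.1, ω.2.1)) = dataLaw π P n := by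
  refine Measure.ext_of_lintegral _ fun f hf => ?_
  rw [lintegral_map hf (by fun_prop), lintegral_joint π P n (f := fun ω => f (ω.1, ω.2.1))
    (by fun_prop), lintegral_dataLaw π P n hf]
  simp

lemma measurable_insertNth {α : Type*} [MeasurableSpace α] {n : ℕ} (i : Fin (n + 1)) :
    Measurable fun p : α × (Fin n → α) => (i.insertNth p.1 p.2 : Fin (n + 1) → α) :=
  (MeasurableEquiv.piFinSuccAbove (fun _ => α) i).symm.measurable

lemma measurable_removeNth {α : Type*} [MeasurableSpace α] {n : ℕ} (i : Fin (n + 1)) :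
    Measurable fun z : Fin (n + 1) → α => (i.removeNth z : Fin n → α) :=
  measurable_pi_iff.2 fun _ => measurable_pi_apply _

lemma measurable_insertSample {n : ℕ} (i : Fin (n + 1)) :
    Measurable fun ω : 𝒲 × (Fin n → 𝒵) × 𝒵 =>
      (ω.1, (i.insertNth ω.2.2 ω.2.1 : Fin (n + 1) → 𝒵)) :=
  measurable_fst.prodMk ((measurable_insertNth i).comp
    ((measurable_snd.comp measurable_snd).prodMk (measurable_fst.comp measurable_snd)))

/-- The fresh sample can be put at any place of the data set. -/
lemma joint_map_insertNth {n : ℕ} (i : Fin (n + 1)) :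
    (joint π P n).map (fun ω => (ω.1, (i.insertNth ω.2.2 ω.2.1 : Fin (n + 1) → 𝒵)))
      = dataLaw π P (n + 1) := by
  refine Measure.ext_of_lintegral _ fun f hf => ?_
  rw [lintegral_map hf (measurable_insertSample i), lintegral_joint π P n
    (f := fun ω => f (ω.1, i.insertNth ω.2.2 ω.2.1)) (hf.comp (measurable_insertSample i)),
    lintegral_dataLaw π P _ hf]
  refine lintegral_congr fun w => ?_
  have h := (measurePreserving_piFinSuccAbove (fun _ : Fin (n + 1) => P w) i).symm
  have hf' : Measurable fun z => f (w, z) := hf.comp measurable_prodMk_left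
  rw [← h.lintegral_comp hf']
  exact (lintegral_prod_symm
    (fun a => f (w, (MeasurableEquiv.piFinSuccAbove (fun _ => 𝒵) i).symm a))
    (hf'.comp h.measurable).aemeasurable).symm

lemma dataLaw_map_init (n : ℕ) :
    (dataLaw π P (n + 1)).map (fun ω => (ω.1, fun j : Fin n => ω.2 j.castSucc))
      = dataLaw π P n := by
  rw [← joint_map_insertNth π P (Fin.last n), Measure.map_map (by fun_prop)
    (measurable_insertSample _), ← joint_map_data]
  congr 1
  ext ω
  · rfl
  · simp

lemma dataLaw_map_eval {n : ℕ} (i : Fin n) :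
    (dataLaw π P n).map (fun ω => (ω.1, ω.2 i)) = π.compProd P := by
  refine Measure.ext_of_lintegral _ fun f hf => ?_
  rw [lintegral_map hf (by fun_prop), lintegral_dataLaw π P n (f := fun ω => f (ω.1, ω.2 i))
    (by fun_prop), Measure.lintegral_compProd hf]
  exact lintegral_congr fun w => (measurePreserving_eval (fun _ : Fin n => P w) i).lintegral_comp
    (f := fun z => f (w, z)) (by fun_prop)

lemma joint_map_fresh (n : ℕ) :
    (joint π P n).map (fun ω => (ω.1, ω.2.2)) = π.compProd P := by
  rw [← dataLaw_map_eval π P (Fin.last n), ← joint_map_insertNth π P (Fin.last n),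
    Measure.map_map (by fun_prop) (measurable_insertSample _)]
  congr 1
  ext ω
  · rfl
  · simp

end Data

/-! ### Exchangeability, and superadditivity of the label entropy. -/

section Supervised

variable {𝒲 𝒳 𝒴 : Type*} [MeasurableSpace 𝒲] [MeasurableSpace 𝒳] [MeasurableSpace 𝒴]

/-- The observations of the data set. -/
def obs {n : ℕ} (ω : 𝒲 × (Fin n → 𝒳 × 𝒴)) (i : Fin n) : 𝒳 := (ω.2 i).1

/-- The labels of the data set. -/
def labels {n : ℕ} (ω : 𝒲 × (Fin n → 𝒳 × 𝒴)) (i : Fin n) : 𝒴 := (ω.2 i).2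

lemma measurable_obs {n : ℕ} : Measurable (obs : 𝒲 × (Fin n → 𝒳 × 𝒴) → Fin n → 𝒳) := by
  unfold obs; fun_prop

lemma measurable_labels {n : ℕ} : Measurable (labels : 𝒲 × (Fin n → 𝒳 × 𝒴) → Fin n → 𝒴) := by
  unfold labels; fun_prop

variable (π : Measure 𝒲) [IsProbabilityMeasure π] (P : Kernel 𝒲 (𝒳 × 𝒴)) [IsMarkovKernel P]

/-- The risk `R_ℓ(Y|X,Zⁿ)`. -/
noncomputable def freshRisk {𝒜 : Type*} [MeasurableSpace 𝒜] (ℓ : 𝒴 → 𝒜 → ℝ≥0∞) (n : ℕ) : ℝ≥0∞ :=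
  bayesRisk (joint π P n) ℓ rvY (fun ω => (rvX ω, rvData ω))

/-- By exchangeability, `R_ℓ(Y|X,Zⁿ)` is the risk of predicting the label of any of `n + 1` samples
from its observation and the other samples. -/
lemma freshRisk_eq {𝒜 : Type*} [MeasurableSpace 𝒜] {ℓ : 𝒴 → 𝒜 → ℝ≥0∞}
    (hℓ : Measurable (Function.uncurry ℓ)) {n : ℕ} (i : Fin (n + 1)) :
    freshRisk π P ℓ n = bayesRisk (dataLaw π P (n + 1)) ℓ (fun ω => labels ω i)
      (fun ω => (obs ω i, (i.removeNth ω.2 : Fin n → 𝒳 × 𝒴))) := by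
  rw [← joint_map_insertNth π P i, bayesRisk_map _ hℓ (measurable_insertSample i)]
  · simp [labels, obs, freshRisk, rvX, rvData]
    rfl
  · unfold labels; fun_prop
  · exact (measurable_pi_iff.1 measurable_obs i).prodMk
      ((measurable_removeNth i).comp measurable_snd)

/-- With sample `0` as the target in both cases, the smaller problem is the larger one with the last
sample ignored. -/
lemma freshRisk_succ_le {𝒜 : Type*} [MeasurableSpace 𝒜] {ℓ : 𝒴 → 𝒜 → ℝ≥0∞}
    (hℓ : Measurable (Function.uncurry ℓ)) (n : ℕ) :
    freshRisk π P ℓ (n + 1) ≤ freshRisk π P ℓ n := by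
  rw [freshRisk_eq π P hℓ 0, freshRisk_eq π P hℓ 0, ← dataLaw_map_init π P (n + 1), bayesRisk_map _ hℓ]
  · exact bayesRisk_le_of_comp _ _ _
      (f := fun p : 𝒳 × (Fin (n + 1) → 𝒳 × 𝒴) => (p.1, fun j : Fin n => p.2 j.castSucc))
      (by fun_prop) fun ω => rfl
  · fun_prop
  · unfold labels; fun_prop
  · exact (measurable_pi_iff.1 measurable_obs 0).prodMk
      ((measurable_removeNth 0).comp measurable_snd)

/-- The observations of all samples and the labels of an initial segment are determined by any
later sample's observation and the other samples. -/
lemma freshRisk_le_of_segment [Nonempty 𝒴] {𝒜 : Type*} [MeasurableSpace 𝒜] {ℓ : 𝒴 → 𝒜 → ℝ≥0∞}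
    (hℓ : Measurable (Function.uncurry ℓ)) {n k : ℕ} (hk : k + 1 ≤ n + 1) :
    freshRisk π P ℓ n ≤ bayesRisk (dataLaw π P (n + 1)) ℓ
      (fun ω => labels ω (Fin.castLE hk (Fin.last k)))
      (fun ω => (obs ω, fun j : Fin k => labels ω (Fin.castLE hk j.castSucc))) := by
  classical
  set i := Fin.castLE hk (Fin.last k)
  rw [freshRisk_eq π P hℓ i]
  -- Fills the unknown label at place `i`; it is never read, because only labels before `i` are
  -- extracted.
  let y₀ := Classical.arbitrary 𝒴
  let Z : 𝒳 × (Fin n → 𝒳 × 𝒴) → (Fin (n + 1) → 𝒳 × 𝒴) := fun p => i.insertNth (p.1, y₀) p.2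
  have hZ : Measurable Z := (measurable_insertNth i).comp
    ((measurable_fst.prodMk measurable_const).prodMk measurable_snd)
  refine bayesRisk_le_of_comp _ _ _
    (f := fun p => (fun j => (Z p j).1, fun j : Fin k => (Z p (Fin.castLE hk j.castSucc)).2))
    (by fun_prop) fun ω => ?_
  have hZω : Z (obs ω i, i.removeNth ω.2) = Function.update ω.2 i (obs ω i, y₀) :=
    Fin.insertNth_removeNth _ _ _
  rw [Prod.mk.injEq]
  simp only [hZω]
  constructor <;> funext j
  · by_cases hj : j = i
    · subst hj; simp
    · simp [obs, hj]
  · have hj : Fin.castLE hk j.castSucc ≠ i := by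
      intro h
      have := congrArg Fin.val h
      simp [i] at this
      omega
    exact congrArg Prod.snd (Function.update_of_ne hj _ _).symm

variable [Fintype 𝒴] [Nonempty 𝒴] [MeasurableSingletonClass 𝒴]

/-- The chain rule peels off the last label of the segment. All `n + 1` observations stay visible
throughout, so each term is bounded below by the same `R(Y|X,Zⁿ)`. -/
lemma mul_freshRisk_le_segment (n : ℕ) : ∀ k : ℕ, (hk : k ≤ n + 1) →
    k * freshRisk π P logLoss n ≤ bayesRisk (dataLaw π P (n + 1)) logLoss
      (fun ω (j : Fin k) => labels ω (Fin.castLE hk j)) obs := by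
  classical
  intro k
  induction k with
  | zero => intro _; simp
  | succ k ih =>
    intro hk
    have hinj : Function.Injective fun y : Fin (k + 1) → 𝒴 =>
        ((fun j : Fin k => y j.castSucc), y (Fin.last k)) := by
      intro y y' h
      rw [Prod.mk.injEq] at h
      funext j
      refine Fin.lastCases h.2 (fun j => congrFun h.1 j) j
    have := bayesRisk_logLoss_chain (dataLaw π P (n + 1))
      (f := fun (y : Fin (k + 1) → 𝒴) (j : Fin k) => y j.castSucc) (g := fun y => y (Fin.last k)) hinj
      (C := fun ω j => labels ω (Fin.castLE hk j)) (V := obs)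
      (measurable_pi_iff.2 fun j => measurable_pi_iff.1 measurable_labels _) measurable_obs
    refine le_trans ?_ this
    push_cast
    rw [add_mul, one_mul]
    exact add_le_add (ih (by omega)) (freshRisk_le_of_segment π P measurable_logLoss hk)

lemma mul_freshRisk_le (n : ℕ) :
    (n + 1 : ℕ) * freshRisk π P logLoss n
      ≤ bayesRisk (dataLaw π P (n + 1)) (logLoss (𝒴 := Fin (n + 1) → 𝒴)) labels obs :=
  mul_freshRisk_le_segment π P n (n + 1) le_rfl

/-- `H(Yⁿ⁺¹|Xⁿ⁺¹) ≥ H(Yⁿ|Xⁿ) + H(Y|X,Zⁿ)` if `X` is independent of `W`. -/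
lemma add_freshRisk_le [StandardBorelSpace 𝒳]
    (hind : IndepFun (fun p : 𝒲 × 𝒳 × 𝒴 => p.2.1) (fun p : 𝒲 × 𝒳 × 𝒴 => p.1) (π.compProd P))
    (n : ℕ) :
    bayesRisk (dataLaw π P n) (logLoss (𝒴 := Fin n → 𝒴)) labels obs + freshRisk π P logLoss n
      ≤ bayesRisk (dataLaw π P (n + 1)) (logLoss (𝒴 := Fin (n + 1) → 𝒴)) labels obs := by
  classical
  have hinj : Function.Injective fun y : Fin (n + 1) → 𝒴 =>
      ((fun j : Fin n => y j.castSucc), y (Fin.last n)) := by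
    intro y y' h
    rw [Prod.mk.injEq] at h
    funext j
    refine Fin.lastCases h.2 (fun j => congrFun h.1 j) j
  have hchain := bayesRisk_logLoss_chain (dataLaw π P (n + 1))
    (f := fun (y : Fin (n + 1) → 𝒴) (j : Fin n) => y j.castSucc) (g := fun y => y (Fin.last n)) hinj
    (C := labels) (V := obs) measurable_labels measurable_obs
  refine le_trans (add_le_add ?_ (freshRisk_le_of_segment π P measurable_logLoss le_rfl)) hchain
  let Q := (π.compProd P).map fun p : 𝒲 × 𝒳 × 𝒴 => p.2.1
  have : IsProbabilityMeasure Q := Measure.isProbabilityMeasure_map (by fun_prop)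
  -- Independence of `X` and `W` says that the law of `X` given `w` is almost surely constant; this
  -- makes the fresh `X` independent of `(W, Zⁿ)` in `hprod`.
  have hQ : ∀ᵐ w ∂π, (P w).map Prod.fst = Q := by
    have h1 : π.compProd (P.map Prod.fst) = π.compProd (Kernel.const 𝒲 Q) := by
      rw [Measure.compProd_const]
      have h2 := (indepFun_iff_map_prod_eq_prod_map_map (by fun_prop) (by fun_prop)).1 hind.symm
      have h3 : (π.compProd P).map (fun p : 𝒲 × 𝒳 × 𝒴 => p.1) = π := Measure.fst_compProd π P
      rw [h3] at h2
      rw [← h2]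
      refine Measure.ext_of_lintegral _ fun f hf => ?_
      rw [lintegral_map hf (by fun_prop), Measure.lintegral_compProd hf,
        Measure.lintegral_compProd (f := fun ω : 𝒲 × 𝒳 × 𝒴 => f (ω.1, ω.2.1)) (by fun_prop)]
      refine lintegral_congr fun w => ?_
      rw [Kernel.map_apply _ measurable_fst, lintegral_map (by fun_prop) measurable_fst]
    filter_upwards [Kernel.ae_eq_of_compProd_eq h1] with w hw
    rw [Kernel.map_apply _ measurable_fst, Kernel.const_apply] at hw
    exact hw
  have hprod : (joint π P n).map (fun ω => ((ω.1, ω.2.1), ω.2.2.1)) = (dataLaw π P n).prod Q := by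
    refine Measure.ext_of_lintegral _ fun f hf => ?_
    rw [lintegral_map hf (by fun_prop), lintegral_joint π P n
      (f := fun ω => f ((ω.1, ω.2.1), ω.2.2.1)) (by fun_prop), lintegral_prod _ hf.aemeasurable,
      lintegral_dataLaw π P n (f := fun a => ∫⁻ t, f (a, t) ∂Q) hf.lintegral_prod_right']
    refine lintegral_congr_ae ?_
    filter_upwards [hQ] with w hw
    refine lintegral_congr fun z => ?_
    rw [← hw, lintegral_map (by fun_prop) measurable_fst]
  have hmeas := (measurable_logLoss (𝒴 := Fin n → 𝒴))
  refine (bayesRisk_le_of_prod (dataLaw π P n) (τ := Q) hmeas measurable_labels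
    measurable_obs).trans ?_
  rw [← hprod, bayesRisk_map (Y := fun ω : (𝒲 × (Fin n → 𝒳 × 𝒴)) × 𝒳 => labels ω.1)
      (V := fun ω : (𝒲 × (Fin n → 𝒳 × 𝒴)) × 𝒳 => (obs ω.1, ω.2)) _ hmeas (by fun_prop)
      (measurable_labels.comp measurable_fst)
      ((measurable_obs.comp measurable_fst).prodMk measurable_snd),
    ← joint_map_insertNth π P (Fin.last n), bayesRisk_map _ hmeas (measurable_insertSample _)
      (measurable_pi_iff.2 fun j => measurable_pi_iff.1 measurable_labels _) measurable_obs]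
  have hlab : (fun (ω : 𝒲 × (Fin n → 𝒳 × 𝒴) × 𝒳 × 𝒴) (j : Fin n) =>
      labels (ω.1, ((Fin.last n).insertNth ω.2.2 ω.2.1 : Fin (n + 1) → 𝒳 × 𝒴)) j.castSucc)
      = fun ω => labels (ω.1, ω.2.1) := by
    funext ω j
    simp [labels]
  rw [hlab]
  refine bayesRisk_le_of_comp _ _ _
    (f := fun p : (Fin n → 𝒳) × 𝒳 => ((Fin.last n).insertNth p.2 p.1 : Fin (n + 1) → 𝒳))
    ((measurable_insertNth (Fin.last n)).comp measurable_swap) fun ω => ?_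
  funext j
  refine Fin.lastCases ?_ (fun j => ?_) j <;> simp [obs]

end Supervised

/-! ### Realizable models -/

section Realizable

variable {𝒲 𝒳 : Type*} [MeasurableSpace 𝒲] [MeasurableSpace 𝒳]
  {π : Measure 𝒲} [IsProbabilityMeasure π] {P : Kernel 𝒲 (𝒳 × Fin 2)} [IsMarkovKernel P]
  {g : 𝒳 → 𝒲 → Fin 2}

lemma measurableSet_realized (hg : Measurable (Function.uncurry g)) :
    MeasurableSet {p : 𝒲 × 𝒳 × Fin 2 | p.2.2 = g p.2.1 p.1} :=
  measurableSet_eq_fun (by fun_prop)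
    (hg.comp ((measurable_fst.comp measurable_snd).prodMk measurable_fst))

lemma Realizable.ae_labels (hg : Measurable (Function.uncurry g)) (h : Realizable π P g) (n : ℕ) :
    ∀ᵐ ω ∂(dataLaw π P n), labels ω = fun i => g (obs ω i) ω.1 := by
  have : ∀ i : Fin n, ∀ᵐ ω ∂(dataLaw π P n), labels ω i = g (obs ω i) ω.1 := by
    intro i
    have h' := h
    rw [Realizable, ← dataLaw_map_eval π P i,
      ae_map_iff (by fun_prop) (measurableSet_realized hg)] at h'
    exact h'
  filter_upwards [ae_all_iff.2 this] with ω hω using funext hω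

lemma Realizable.ae_fresh (hg : Measurable (Function.uncurry g)) (h : Realizable π P g) (n : ℕ) :
    ∀ᵐ ω ∂(joint π P n), rvY ω = g (rvX ω) (rvW ω) := by
  rw [Realizable, ← joint_map_fresh π P n,
    ae_map_iff (by fun_prop) (measurableSet_realized hg)] at h
  exact h

/-- If the loss of some measurable action-valued function of the true label vanishes, knowledge of
the model parameters makes the risk vanish. -/
lemma Realizable.bayesRisk_eq_zero {𝒜 : Type*} [MeasurableSpace 𝒜]
    (hg : Measurable (Function.uncurry g)) (h : Realizable π P g) (n : ℕ)
    {ℓ : Fin 2 → 𝒜 → ℝ≥0∞} (a : Fin 2 → 𝒜) (ha : ∀ y, ℓ y (a y) = 0) :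
    bayesRisk (joint π P n) ℓ rvY (fun ω => (rvX ω, rvW ω)) = 0 := by
  have hψ : Measurable fun p : 𝒳 × 𝒲 => a (g p.1 p.2) := (measurable_of_countable a).comp hg
  refine le_antisymm ((bayesRisk_le _ ℓ _ _ hψ).trans_eq ?_) zero_le
  rw [← lintegral_zero (μ := joint π P n)]
  refine lintegral_congr_ae ?_
  filter_upwards [h.ae_fresh hg n] with ω hω
  simp only [hω]
  exact ha _

lemma Realizable.MER01_eq (hg : Measurable (Function.uncurry g)) (h : Realizable π P g) (n : ℕ) :
    MER01 π P n = (freshRisk π P zeroOneLoss n).toReal := by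
  unfold MER01 MER
  rw [h.bayesRisk_eq_zero hg n id (by simp [zeroOneLoss])]
  simp [freshRisk]

lemma Realizable.MERlog_eq (hg : Measurable (Function.uncurry g)) (h : Realizable π P g) (n : ℕ) :
    MERlog π P n = (freshRisk π P logLoss n).toReal := by
  unfold MERlog MER
  rw [h.bayesRisk_eq_zero hg n
    (fun y => (⟨Pi.single y 1, single_mem_stdSimplex ℝ y⟩ : stdSimplex ℝ (Fin 2)))
    (by simp [logLoss])]
  simp [freshRisk]

variable [StandardBorelSpace 𝒲]

/-- The conditional law of the labels given the observations, in a version all of whose atoms are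
realized by model parameters. -/
lemma Realizable.exists_condLaw (hg : Measurable (Function.uncurry g)) (h : Realizable π P g)
    (n : ℕ) :
    ∃ p : (Fin n → 𝒳) → (Fin n → Fin 2) → ℝ≥0∞, (∀ y, Measurable fun x => p x y) ∧
      (∀ x, ∑ y, p x y = 1) ∧
      (∀ x, {y | p x y ≠ 0} ⊆ Set.range fun (w : 𝒲) (i : Fin n) => g (x i) w) ∧
      ∀ F : (Fin n → Fin 2) → (Fin n → 𝒳) → ℝ≥0∞, (∀ y, Measurable (F y)) →
        ∫⁻ ω, F (labels ω) (obs ω) ∂(dataLaw π P n)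
          = ∫⁻ x, ∑ y, p x y * F y x ∂((dataLaw π P n).map obs) := by
  have : Nonempty 𝒲 := nonempty_of_isProbabilityMeasure π
  -- Conditioning `W` rather than the labels, then pushing forward by `w ↦ g(x, w)`, makes every
  -- pattern of positive mass realized by some `w`, for every `x` and not just almost every `x`.
  let ν := condDistrib (fun ω : 𝒲 × (Fin n → 𝒳 × Fin 2) => ω.1) obs (dataLaw π P n)
  let G : (Fin n → 𝒳) × 𝒲 → Fin n → Fin 2 := fun q i => g (q.1 i) q.2
  have hG : Measurable G := measurable_pi_iff.2 fun i =>
    hg.comp (f := fun q : (Fin n → 𝒳) × 𝒲 => (q.1 i, q.2))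
      (((measurable_pi_apply i).comp measurable_fst).prodMk measurable_snd)
  have hGx : ∀ x, Measurable fun w => G (x, w) := fun x => hG.comp measurable_prodMk_left
  refine ⟨fun x y => ν x {w | G (x, w) = y}, fun y => ?_, fun x => ?_, fun x y hy => ?_,
    fun F hF => ?_⟩
  · exact Kernel.measurable_kernel_prodMk_left (t := {q | G q = y}) (hG (measurableSet_singleton y))
  · have := sum_measure_preimage_singleton (μ := ν x) Finset.univ (f := fun w => G (x, w))
      fun y _ => hGx x (measurableSet_singleton y)
    simpa [Set.preimage] using this
  · obtain ⟨w, hw⟩ := nonempty_of_measure_ne_zero hy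
    exact ⟨w, hw⟩
  · have hF' : Measurable fun q : (Fin n → 𝒳) × 𝒲 => F (G q) q.1 :=
      (measurable_from_prod_countable_right (f := fun q : (Fin n → Fin 2) × (Fin n → 𝒳) =>
        F q.1 q.2) hF).comp (hG.prodMk measurable_fst)
    calc ∫⁻ ω, F (labels ω) (obs ω) ∂(dataLaw π P n)
        = ∫⁻ ω, F (G (obs ω, ω.1)) (obs ω) ∂(dataLaw π P n) := by
          refine lintegral_congr_ae ?_
          filter_upwards [h.ae_labels hg n] with ω hω
          rw [hω]
      _ = ∫⁻ q, F (G q) q.1 ∂((dataLaw π P n).map fun ω => (obs ω, ω.1)) :=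
          (lintegral_map hF' (measurable_obs.prodMk measurable_fst)).symm
      _ = ∫⁻ x, ∫⁻ w, F (G (x, w)) x ∂(ν x) ∂((dataLaw π P n).map obs) := by
          rw [← compProd_map_condDistrib measurable_fst.aemeasurable,
            Measure.lintegral_compProd hF']
      _ = _ := by
          refine lintegral_congr fun x => ?_
          rw [← lintegral_map (f := fun y => F y x) (measurable_of_countable _) (hGx x),
            lintegral_fintype]
          refine Finset.sum_congr rfl fun y _ => ?_
          rw [Measure.map_apply (hGx x) (measurableSet_singleton y), mul_comm]
          rfl

variable {d : ℕ}

/-- The one-inclusion graph bound for the zero-one Bayes risk. -/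
lemma Realizable.mul_freshRisk_zeroOneLoss_le (hg : Measurable (Function.uncurry g))
    (h : Realizable π P g) (hd : vcDim g = d) (n : ℕ) :
    (n + 1 : ℕ) * freshRisk π P zeroOneLoss n ≤ d := by
  obtain ⟨p, hp, hsum, hsupp, hF⟩ := h.exists_condLaw hg (n + 1)
  -- The loss at place `i` of the rule choosing the likelier of the two completions of the other
  -- labels; it does not look at `y i` to predict.
  let F : Fin (n + 1) → (Fin (n + 1) → Fin 2) → (Fin (n + 1) → 𝒳) → ℝ≥0∞ := fun i y x =>
    zeroOneLoss (y i) (if p x (Function.update y i 0) ≤ p x (Function.update y i 1) then 1 else 0)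
  have hFm : ∀ i y, Measurable (F i y) := fun i y =>
    measurable_zeroOneLoss.comp (measurable_const.prodMk
      (Measurable.ite (measurableSet_le (hp _) (hp _)) measurable_const measurable_const))
  have hrisk : ∀ i : Fin (n + 1), freshRisk π P zeroOneLoss n
      ≤ ∫⁻ x, ∑ y, p x y * F i y x ∂((dataLaw π P (n + 1)).map obs) := by
    intro i
    rw [← hF (F i) (hFm i), freshRisk_eq π P measurable_zeroOneLoss i]
    let X : 𝒳 × (Fin n → 𝒳 × Fin 2) → Fin (n + 1) → 𝒳 := fun q =>
      i.insertNth q.1 fun j => (q.2 j).1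
    let Y : Fin 2 → 𝒳 × (Fin n → 𝒳 × Fin 2) → Fin (n + 1) → Fin 2 := fun b q =>
      i.insertNth b fun j => (q.2 j).2
    have hX : Measurable X := (measurable_insertNth i).comp
      (f := fun q : 𝒳 × (Fin n → 𝒳 × Fin 2) => (q.1, fun j => (q.2 j).1)) (by fun_prop)
    have hY : ∀ b, Measurable (Y b) := fun b =>
      (measurable_insertNth i).comp (measurable_const.prodMk (by fun_prop))
    have hp' : Measurable fun q : (Fin (n + 1) → 𝒳) × (Fin (n + 1) → Fin 2) => p q.1 q.2 :=
      measurable_from_prod_countable_left hp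
    have hψ : Measurable fun q => if p (X q) (Y 0 q) ≤ p (X q) (Y 1 q) then (1 : Fin 2) else 0 :=
      Measurable.ite (measurableSet_le (hp'.comp (hX.prodMk (hY 0))) (hp'.comp (hX.prodMk (hY 1))))
        measurable_const measurable_const
    refine (bayesRisk_le _ _ _ _ hψ).trans_eq (lintegral_congr fun ω => ?_)
    have hXω : X (obs ω i, i.removeNth ω.2) = obs ω := Fin.insertNth_self_removeNth i (obs ω)
    have hYω : ∀ b, Y b (obs ω i, i.removeNth ω.2) = Function.update (labels ω) i b := fun b =>
      Fin.insertNth_removeNth i b (labels ω)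
    simp only [hXω, hYω, F]
  -- On each edge in direction `i` the rule errs on the lighter end point, so the errors sum to the
  -- edge weights of the one-inclusion bound.
  have hpt : ∀ x, ∑ i, ∑ y, p x y * F i y x ≤ d := by
    intro x
    have hb := ((shatterBound_of_vcDim hd x).mono (hsupp x)).sum_min_insertNth_le (p x)
    rw [hsum x, mul_one] at hb
    refine le_trans (le_of_eq ?_) hb
    refine Finset.sum_congr rfl fun i _ => ?_
    rw [sum_eq_sum_insertNth i]
    refine Finset.sum_congr rfl fun y _ => ?_
    simp only [F, Fin.update_insertNth, Fin.insertNth_apply_same]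
    split_ifs with hle
    · simp [zeroOneLoss, hle]
    · simp [zeroOneLoss, (not_le.1 hle).le]
  have hprob : IsProbabilityMeasure ((dataLaw π P (n + 1)).map obs) :=
    Measure.isProbabilityMeasure_map measurable_obs.aemeasurable
  calc (n + 1 : ℕ) * freshRisk π P zeroOneLoss n
      = ∑ _i : Fin (n + 1), freshRisk π P zeroOneLoss n := by simp
    _ ≤ ∑ i, ∫⁻ x, ∑ y, p x y * F i y x ∂((dataLaw π P (n + 1)).map obs) :=
        Finset.sum_le_sum fun i _ => hrisk i
    _ = ∫⁻ x, ∑ i, ∑ y, p x y * F i y x ∂((dataLaw π P (n + 1)).map obs) :=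
        (lintegral_finsetSum _ fun i _ =>
          Finset.measurable_sum _ fun y _ => (hp y).mul (hFm i y)).symm
    _ ≤ ∫⁻ _, d ∂((dataLaw π P (n + 1)).map obs) := lintegral_mono hpt
    _ = d := by simp

/-- The conditional entropy of the labels is bounded by the logarithm of the growth function. -/
lemma Realizable.bayesRisk_labels_le (hg : Measurable (Function.uncurry g))
    (h : Realizable π P g) (hd : vcDim g = d) (n : ℕ) :
    bayesRisk (dataLaw π P n) (logLoss (𝒴 := Fin n → Fin 2)) labels obs
      ≤ ENNReal.ofReal (d * Real.log (n + 1)) := by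
  classical
  obtain ⟨p, hp, hsum, hsupp, hF⟩ := h.exists_condLaw hg n
  let V : (Fin n → 𝒳) → Finset (Fin n → Fin 2) := fun x => {y | p x y ≠ 0}
  have hV : ∀ x, (V x).card ≤ (n + 1) ^ d := fun x => ShatterBound.card_le (V x)
    ((shatterBound_of_vcDim hd x).mono (by simpa [V] using hsupp x))
  have hV0 : ∀ x, 0 < (V x).card := fun x => by
    obtain ⟨y, -, hy⟩ := Finset.exists_ne_zero_of_sum_ne_zero ((hsum x).trans_ne one_ne_zero)
    exact Finset.card_pos.2 ⟨y, by simpa [V] using hy⟩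
  have hcard : ∀ x, ((V x).card : ℝ) = ∑ y, if p x y ≠ 0 then 1 else 0 := fun x => by
    rw [Finset.sum_boole]
  -- Predict uniformly on the support `V x`: the loss is then `log` of its cardinality wherever `p x
  -- y ≠ 0`.
  let q : (Fin n → 𝒳) → stdSimplex ℝ (Fin n → Fin 2) := fun x =>
    ⟨fun y => (if p x y ≠ 0 then 1 else 0) / (V x).card, fun y => by positivity, by
      rw [← Finset.sum_div, ← hcard, div_self (Nat.cast_ne_zero.2 (hV0 x).ne')]⟩
  have hi : ∀ y, Measurable fun x => if p x y ≠ 0 then (1 : ℝ) else 0 := fun y =>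
    Measurable.ite (hp y (measurableSet_singleton 0).compl) measurable_const measurable_const
  have hq : Measurable q := by
    refine Measurable.subtype_mk (measurable_pi_iff.2 fun y => (hi y).div ?_)
    simp only [hcard]
    exact Finset.measurable_sum _ fun y _ => hi y
  refine (bayesRisk_le _ _ _ _ hq).trans ?_
  rw [hF (fun y x => logLoss y (q x)) fun y => (measurable_logLoss_apply y).comp hq]
  have hprob : IsProbabilityMeasure ((dataLaw π P n).map obs) :=
    Measure.isProbabilityMeasure_map measurable_obs.aemeasurable
  calc _ ≤ ∫⁻ _, ENNReal.ofReal (d * Real.log (n + 1)) ∂((dataLaw π P n).map obs) := by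
        refine lintegral_mono fun x => ?_
        calc ∑ y, p x y * logLoss y (q x)
            ≤ ∑ y, p x y * ENNReal.ofReal (d * Real.log (n + 1)) := by
              refine Finset.sum_le_sum fun y _ => ?_
              by_cases hy : p x y = 0
              · simp [hy]
              gcongr
              have hc : (0 : ℝ) < (V x).card := Nat.cast_pos.2 (hV0 x)
              have hqy : (q x).1 y = ((V x).card : ℝ)⁻¹ := by simp [q, hy]
              rw [logLoss, hqy, if_neg (by positivity), Real.log_inv, neg_neg, ← Real.log_pow]
              refine ENNReal.ofReal_le_ofReal (Real.log_le_log hc ?_)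
              exact_mod_cast hV x
          _ = ENNReal.ofReal (d * Real.log (n + 1)) := by rw [← Finset.sum_mul, hsum, one_mul]
    _ = _ := by simp

end Realizable

/-! ### Bounds in terms of entropies -/

section EntropyBounds

variable {𝒲 𝒳 : Type*} [MeasurableSpace 𝒲] [MeasurableSpace 𝒳]
  (π : Measure 𝒲) [IsProbabilityMeasure π] (P : Kernel 𝒲 (𝒳 × Fin 2)) [IsMarkovKernel P]

lemma measurable_rvY {n : ℕ} :
    Measurable (rvY : 𝒲 × (Fin n → 𝒳 × Fin 2) × (𝒳 × Fin 2) → Fin 2) := by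
  unfold rvY; fun_prop

lemma measurable_rvX_rvData {n : ℕ} :
    Measurable fun ω : 𝒲 × (Fin n → 𝒳 × Fin 2) × (𝒳 × Fin 2) => (rvX ω, rvData ω) := by
  unfold rvX rvData; fun_prop

lemma freshRisk_logLoss (n : ℕ) :
    freshRisk π P logLoss n = ENNReal.ofReal (entropyFresh π P n) :=
  bayesRisk_logLoss _ measurable_rvY measurable_rvX_rvData

lemma entropyFresh_nonneg (n : ℕ) : 0 ≤ entropyFresh π P n := condEntropy_nonneg _ _ _

lemma entropyData_nonneg (n : ℕ) : 0 ≤ entropyData π P n := condEntropy_nonneg _ _ _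

lemma bayesRisk_labels (n : ℕ) :
    bayesRisk (dataLaw π P n) (logLoss (𝒴 := Fin n → Fin 2)) labels obs
      = ENNReal.ofReal (entropyData π P n) := by
  rw [← joint_map_data, bayesRisk_map _ measurable_logLoss (by fun_prop) measurable_labels
    measurable_obs]
  exact bayesRisk_logLoss (joint π P n) (Y := rvYs) (V := rvXs) (by unfold rvYs; fun_prop)
    (by unfold rvXs; fun_prop)

lemma MER01_le (n : ℕ) : MER01 π P n ≤ 1 / 2 * (entropyFresh π P n / Real.log 2) := by
  have h := ENNReal.toReal_mono ENNReal.ofReal_ne_top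
    (bayesRisk_zeroOneLoss_le (joint π P n) measurable_rvY measurable_rvX_rvData)
  rw [ENNReal.toReal_ofReal (mul_nonneg (by norm_num) (div_nonneg (condEntropy_nonneg _ _ _)
    (Real.log_nonneg one_le_two)))] at h
  exact (sub_le_self _ ENNReal.toReal_nonneg).trans h

lemma MERlog_le (n : ℕ) : MERlog π P n ≤ entropyFresh π P n := by
  refine (sub_le_self _ ENNReal.toReal_nonneg).trans_eq ?_
  change (freshRisk π P logLoss n).toReal = _
  rw [freshRisk_logLoss, ENNReal.toReal_ofReal (entropyFresh_nonneg π P n)]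

lemma mul_entropyFresh_le (n : ℕ) :
    ((n : ℝ) + 1) * entropyFresh π P n ≤ entropyData π P (n + 1) := by
  have h := mul_freshRisk_le π P n
  rw [freshRisk_logLoss, bayesRisk_labels, ← ENNReal.ofReal_natCast,
    ← ENNReal.ofReal_mul (by positivity),
    ENNReal.ofReal_le_ofReal_iff (entropyData_nonneg π P _)] at h
  exact_mod_cast h

/-- `mul_entropyFresh_le` at `n - 1` bounds the entropy after `n - 1` samples; monotonicity passes
to `n`. -/
lemma entropyFresh_le_entropyData {n : ℕ} (hn : 1 ≤ n) :
    entropyFresh π P n ≤ 1 / n * entropyData π P n := by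
  obtain ⟨m, rfl⟩ := Nat.exists_eq_add_of_le' hn
  have h := freshRisk_succ_le π P (measurable_logLoss (𝒴 := Fin 2)) m
  rw [freshRisk_logLoss, freshRisk_logLoss,
    ENNReal.ofReal_le_ofReal_iff (entropyFresh_nonneg π P _)] at h
  have h2 := mul_entropyFresh_le π P m
  have hm : (0 : ℝ) < m + 1 := by positivity
  push_cast
  rw [one_div, ← div_eq_inv_mul, le_div_iff₀ hm]
  nlinarith

variable {π P} {g : 𝒳 → 𝒲 → Fin 2} {d : ℕ}

lemma Realizable.entropyData_le [StandardBorelSpace 𝒲] (hg : Measurable (Function.uncurry g))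
    (h : Realizable π P g) (hd : vcDim g = d) (n : ℕ) :
    entropyData π P n ≤ d * Real.log (n + 1) := by
  have := h.bayesRisk_labels_le hg hd n
  rwa [bayesRisk_labels, ENNReal.ofReal_le_ofReal_iff
    (mul_nonneg (by positivity) (Real.log_nonneg (by linarith [n.cast_nonneg (α := ℝ)])))] at this

lemma Realizable.MER01_bounds [StandardBorelSpace 𝒲] (hg : Measurable (Function.uncurry g))
    (h : Realizable π P g) (hd : vcDim g = d) (n : ℕ) :
    0 ≤ MER01 π P n ∧ (n + 1) * MER01 π P n ≤ d := by
  rw [h.MER01_eq hg]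
  refine ⟨ENNReal.toReal_nonneg, ?_⟩
  have := ENNReal.toReal_mono (by simp) (h.mul_freshRisk_zeroOneLoss_le hg hd n)
  rw [ENNReal.toReal_mul, ENNReal.toReal_natCast, ENNReal.toReal_natCast] at this
  exact_mod_cast this

lemma sum_entropyFresh_le [StandardBorelSpace 𝒳]
    (hind : IndepFun (fun p : 𝒲 × 𝒳 × Fin 2 => p.2.1) (fun p : 𝒲 × 𝒳 × Fin 2 => p.1)
      (π.compProd P)) (n : ℕ) :
    ∑ i ∈ Finset.range n, entropyFresh π P i ≤ entropyData π P n := by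
  induction n with
  | zero => simpa using entropyData_nonneg π P 0
  | succ n ih =>
    have := add_freshRisk_le π P hind n
    rw [freshRisk_logLoss, bayesRisk_labels, bayesRisk_labels,
      ← ENNReal.ofReal_add (entropyData_nonneg π P n) (entropyFresh_nonneg π P n),
      ENNReal.ofReal_le_ofReal_iff (entropyData_nonneg π P _)] at this
    rw [Finset.sum_range_succ]
    linarith

end EntropyBounds

/-- A sequence whose partial sums are at most `d log (n + 1)` cannot eventually exceed `c / (n + 1)`
for any `c > d`. -/
lemma not_eventually_le_of_sum_le {h : ℕ → ℝ} (h0 : ∀ n, 0 ≤ h n) {d c : ℝ} (hc : d < c)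
    (hc0 : 0 ≤ c) (hs : ∀ n : ℕ, ∑ i ∈ Finset.range n, h i ≤ d * Real.log (n + 1)) :
    ¬ ∀ᶠ n : ℕ in atTop, c ≤ (n + 1) * h n := by
  intro hev
  obtain ⟨N, hN⟩ := eventually_atTop.1 hev
  have hlog : Tendsto (fun n : ℕ => (c - d) * Real.log ((n : ℝ) + 1)) atTop atTop :=
    (Real.tendsto_log_atTop.comp (tendsto_atTop_add_const_right _ 1
      tendsto_natCast_atTop_atTop)).const_mul_atTop (sub_pos.2 hc)
  obtain ⟨n, hn, hNn⟩ := ((hlog.eventually_gt_atTop (c * ∑ i ∈ Finset.range N, ((i : ℝ) + 1)⁻¹)).and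
    (eventually_ge_atTop N)).exists
  have hharm := log_add_one_le_harmonic n
  simp only [harmonic] at hharm
  push_cast at hharm
  -- The first `N` harmonic terms are paid for by a fixed constant, which `(c - d) * log (n + 1)`
  -- exceeds by the choice of `n`.
  have hle : ∀ i : ℕ, c * ((i : ℝ) + 1)⁻¹ ≤ h i + if i < N then c * ((i : ℝ) + 1)⁻¹ else 0 := by
    intro i
    split_ifs with hi
    · linarith [h0 i]
    · have := hN i (not_lt.1 hi)
      rw [add_zero, ← div_eq_mul_inv, div_le_iff₀ (by positivity)]
      linarith
  have hsum := Finset.sum_le_sum fun i (_ : i ∈ Finset.range n) => hle i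
  rw [Finset.sum_add_distrib, ← Finset.sum_filter] at hsum
  have hf : (Finset.range n).filter (fun i => i < N) = Finset.range N := by
    ext i; simp only [Finset.mem_filter, Finset.mem_range]; omega
  rw [hf, ← Finset.mul_sum, ← Finset.mul_sum] at hsum
  have := mul_le_mul_of_nonneg_left hharm hc0
  have := hs n
  linarith

end BayesMER

theorem mainTheorem7 {𝒲 𝒳 : Type*} [MeasurableSpace 𝒲] [StandardBorelSpace 𝒲]
    [MeasurableSpace 𝒳] [StandardBorelSpace 𝒳]
    (π : Measure 𝒲) [IsProbabilityMeasure π]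
    (P : Kernel 𝒲 (𝒳 × Fin 2)) [IsMarkovKernel P] :
    -- the entropy bounds (division by `log 2` converts an entropy from nats to bits)
    (∀ n : ℕ, 1 ≤ n →
      (BayesMER.MER01 π P n ≤ 1 / 2 * (BayesMER.entropyFresh π P n / Real.log 2) ∧
        1 / 2 * (BayesMER.entropyFresh π P n / Real.log 2)
          ≤ 1 / (2 * (n : ℝ)) * (BayesMER.entropyData π P n / Real.log 2)) ∧
      (1 / 2 * BayesMER.MERlog π P n ≤ 1 / 2 * BayesMER.entropyFresh π P n ∧
        1 / 2 * BayesMER.entropyFresh π P n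
          ≤ 1 / (2 * (n : ℝ)) * BayesMER.entropyData π P n)) ∧
    -- realizable models
    (∀ (g : 𝒳 → 𝒲 → Fin 2) (d : ℕ), Measurable (Function.uncurry g) →
      BayesMER.Realizable π P g → BayesMER.vcDim g = d →
      -- zero-one loss, with an absolute implied constant
      (Asymptotics.IsBigOWith 2 atTop (fun n : ℕ => BayesMER.MER01 π P n)
        (fun n : ℕ => (d : ℝ) / (2 * (n : ℝ)))) ∧
      -- log loss, without further assumptions
      (∀ n : ℕ, 1 ≤ n →
        1 / 2 * BayesMER.MERlog π P n ≤ (d : ℝ) * Real.log ((n : ℝ) + 1) / (2 * (n : ℝ))) ∧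
      -- log loss, when `lim (n + 1) H(Y|X,Zⁿ)` exists
      (∀ L : ℝ, Tendsto (fun n : ℕ => ((n : ℝ) + 1) * BayesMER.entropyFresh π P n) atTop (𝓝 L) →
        (fun n : ℕ => 1 / 2 * BayesMER.MERlog π P n)
          =O[atTop] (fun n : ℕ => (d : ℝ) / (2 * (n : ℝ)))) ∧
      -- log loss, when moreover `X` is independent of `W`: any implied constant above `1`
      (IndepFun (fun p : 𝒲 × 𝒳 × Fin 2 => p.2.1) (fun p : 𝒲 × 𝒳 × Fin 2 => p.1) (π.compProd P) →
        ∀ L : EReal,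
          Tendsto (fun n : ℕ => ((((n : ℝ) + 1) * BayesMER.entropyFresh π P n : ℝ) : EReal))
            atTop (𝓝 L) →
          ∀ c : ℝ, 1 < c →
            Asymptotics.IsBigOWith c atTop (fun n : ℕ => 1 / 2 * BayesMER.MERlog π P n)
              (fun n : ℕ => (d : ℝ) / (2 * (n : ℝ))))) := by
  have hfresh := BayesMER.entropyFresh_nonneg π P
  refine ⟨fun n hn => ?_, fun g d hg hreal hd => ?_⟩
  · have h := BayesMER.entropyFresh_le_entropyData π P hn
    have hn0 : (0 : ℝ) < n := by exact_mod_cast hn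
    have hhalf : ∀ x : ℝ, 1 / (2 * (n : ℝ)) * x = 1 / 2 * (1 / n * x) := fun x => by
      field_simp
    refine ⟨⟨BayesMER.MER01_le π P n, ?_⟩, ?_, ?_⟩
    · have h2 := div_le_div_of_nonneg_right h (Real.log_nonneg one_le_two)
      rw [mul_div_assoc] at h2
      rw [hhalf]
      gcongr
    · linarith [BayesMER.MERlog_le π P n]
    · rw [hhalf]
      gcongr
  have hdata := hreal.entropyData_le hg hd
  have hmer0 : ∀ n, 0 ≤ BayesMER.MERlog π P n := fun n => by
    rw [hreal.MERlog_eq hg]; exact ENNReal.toReal_nonneg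
  have hmer := BayesMER.MERlog_le π P
  -- For `d = 0` the comparison function is zero, so a rate means exact vanishing.
  have hzero : d = 0 → ∀ n, BayesMER.MERlog π P n = 0 := fun h0 n => by
    have h1 := BayesMER.mul_entropyFresh_le π P n
    have h2 := hdata (n + 1)
    rw [h0, Nat.cast_zero, zero_mul] at h2
    have h3 : BayesMER.entropyFresh π P n ≤ 0 := by
      by_contra hc
      have : 0 < ((n : ℝ) + 1) * BayesMER.entropyFresh π P n :=
        mul_pos (by positivity) (not_le.1 hc)
      linarith
    exact le_antisymm ((hmer n).trans h3) (hmer0 n)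
  -- A bound on `(n + 1) H(Y|X,Zⁿ)` gives the corresponding rate.
  have hrate : ∀ C : ℝ, 0 ≤ C →
      (∀ᶠ n : ℕ in atTop, ((n : ℝ) + 1) * BayesMER.entropyFresh π P n ≤ C * d) →
      Asymptotics.IsBigOWith C atTop (fun n : ℕ => 1 / 2 * BayesMER.MERlog π P n)
        (fun n : ℕ => (d : ℝ) / (2 * (n : ℝ))) := by
    intro C hC hev
    rw [Asymptotics.isBigOWith_iff]
    filter_upwards [hev, eventually_gt_atTop 0] with n hn hn0
    have hn0' : (0 : ℝ) < n := by exact_mod_cast hn0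
    rw [Real.norm_of_nonneg (mul_nonneg (by norm_num) (hmer0 n)),
      Real.norm_of_nonneg (by positivity), ← mul_div_assoc, le_div_iff₀ (by positivity)]
    nlinarith [hmer n, hfresh n]
  refine ⟨?_, fun n hn => ?_, fun L hL => ?_, fun hind L hL c hc => ?_⟩
  · rw [Asymptotics.isBigOWith_iff]
    filter_upwards [eventually_gt_atTop 0] with n hn0
    have hn0' : (0 : ℝ) < n := by exact_mod_cast hn0
    -- The constant `2` only cancels the `2` in `d / (2 * n)`: the actual bound is `d / (n + 1)`.
    obtain ⟨h0, h1⟩ := hreal.MER01_bounds hg hd n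
    rw [Real.norm_of_nonneg h0, Real.norm_of_nonneg (by positivity), ← mul_div_assoc,
      le_div_iff₀ (by positivity)]
    linarith
  · have hn0 : (0 : ℝ) < n := by exact_mod_cast hn
    have h := BayesMER.entropyFresh_le_entropyData π P hn
    rw [one_div, ← div_eq_inv_mul, le_div_iff₀ hn0] at h
    rw [le_div_iff₀ (by positivity)]
    nlinarith [hmer n, hdata n]
  · rcases Nat.eq_zero_or_pos d with h0 | hpos
    · simp only [hzero h0, mul_zero]
      exact Asymptotics.isBigO_zero _ _
    have hd1 : (1 : ℝ) ≤ d := by exact_mod_cast hpos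
    -- Eventually the sequence is at most `|L| + 1`, hence at most `(|L| + 1) * d` because `d ≥ 1`.
    refine (hrate (|L| + 1) (by positivity) ?_).isBigO
    filter_upwards [hL.eventually_le_const (lt_of_le_of_lt (le_abs_self L) (lt_add_one |L|))]
      with n hn
    exact hn.trans (le_mul_of_one_le_right (by positivity) hd1)
  · rcases Nat.eq_zero_or_pos d with h0 | hpos
    · simp [hzero h0, h0, Asymptotics.isBigOWith_iff]
    have hd0 : (0 : ℝ) < d := by exact_mod_cast hpos
    -- If `L ≥ c * d`, the sequence need not eventually reach `c * d`, but it does exceed `c' * d`,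
    -- which is still above `d`.
    obtain ⟨c', hc'1, hc'⟩ := exists_between hc
    refine hrate c (by linarith) ?_
    rcases lt_or_ge L ((c * d : ℝ) : EReal) with hLc | hLc
    · filter_upwards [hL.eventually_lt_const hLc] with n hn
      exact (EReal.coe_lt_coe_iff.1 hn).le
    · exfalso
      refine BayesMER.not_eventually_le_of_sum_le (d := d) (c := c' * d) hfresh
        (by nlinarith) (by positivity)
        (fun n => (BayesMER.sum_entropyFresh_le hind n).trans (hdata n)) ?_
      have hlt : ((c' * d : ℝ) : EReal) < L :=
        lt_of_lt_of_le (EReal.coe_lt_coe_iff.2 (by nlinarith)) hLc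
      filter_upwards [hL.eventually_const_lt hlt] with n hn
      exact (EReal.coe_lt_coe_iff.1 hn).le
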